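/- **Notation.** Let $d\in\mathbb N$ and let $L(\mathbb T^d)$ be the space of functions on $\mathbb R^d$ that are $2\pi$-periodic in each variable and integrable over the period cube $\mathbb T^d$. Put $\widehat f(\mathbf k)=(2\pi)^{-d}\int_{\mathbb T^d}f(\mathbf x)e^{-i(\mathbf k,\mathbf x)}\,d\mathbf x$, $|\mathbf k|_1=\sum_j|k_j|$ and $H_\nu(f)(\mathbf x)=\sum_{|\mathbf k|_1=\nu}\widehat f(\mathbf k)e^{i(\mathbf k,\mathbf x)}$. For a trigonometric series $c=\sum_{\mathbf k\in\mathbb Z^d}c_{\mathbf k}e^{i(\mathbf k,\mathbf x)}$ let $\|c\|_{\mathcal S^p}=(\sum_{\mathbf k}|c_{\mathbf k}|^p)^{1/p}\in[0,\infty]$; the norm of a function is that of its Fourier series. For $r\in\mathbb N$ and $0\le\varrho<1$ the triangular Taylor–Abel–Poisson mean is $$A^\Delta_{\varrho,r}(f)=\sum_{\nu=0}^{r-1}H_\nu(f)+\sum_{\nu=r}^\infty\lambda_{\nu,r}(\varrho)H_\nu(f),\qquad \lambda_{\nu,r}(\varrho)=\sum_{k=0}^{r-1}\binom{\nu}{k}(1-\varrho)^k\varrho^{\nu-k}.$$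 For $m\in\mathbb N_0$ let $f^{[m]}$ be the trigonometric series with coefficients $\frac{\nu!}{(\nu-m)!}\widehat f(\mathbf k)$ for $|\mathbf k|_1=\nu\ge m$ and $0$ for $|\mathbf k|_1<m$; when it is the Fourier series of a function in $L(\mathbb T^d)$, it is identified with that function. The Poisson integral of a series $c$ is $P(c)(\varrho,\mathbf x)=\sum_{\nu\ge0}\varrho^\nu\sum_{|\mathbf k|_1=\nu}c_{\mathbf k}e^{i(\mathbf k,\mathbf x)}$; that of a function $g\in L(\mathbb T^d)$ is $(2\pi)^{-d}\int_{\mathbb T^d}g(\mathbf x+\mathbf t)\prod_{j=1}^d\frac{1-\varrho^2}{1-2\varrho\cos t_j+\varrho^2}\,d\mathbf t$. We write $c\in\mathcal S^pH^1_\omega$ if $\|c\|_{\mathcal S^p}<\infty$ and $\sup_{|h|\le\delta}\|c-c(\cdot-h)\|_{\mathcal S^p}=O(\omega(\delta))$ as $\delta\to0+$; here $h\in\mathbb R$ is subtracted from every variable, so $c(\cdot-h)$ has the coefficients $c_{\mathbf k}e^{-ih(k_1+\dots+k_d)}$. **Theorem 3.4.** Let $1\le p<\infty$, $r\in\mathbb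 N$, $d\in\mathbb N$, $f\in L(\mathbb T^d)$. Let $\omega$ be continuous and nondecreasing on $[0,1]$, nonzero on $(0,1]$, with $\omega(\delta)\to0$ as $\delta\to0$, and let $\sum_{v=n+1}^\infty\frac1v\,\omega(\frac1v)=O(\omega(\frac1n))$ (Bari's condition). Consider the conditions * i) $\|f-A^\Delta_{\varrho,r}(f)\|_{\mathcal S^p}=O\big((1-\varrho)^{r-1}\omega(1-\varrho)\big)$, $\varrho\to1-$; * ii) $\|P(f^{[r]})(\varrho,\cdot)\|_{\mathcal S^p}=O\big(\frac{\omega(1-\varrho)}{1-\varrho}\big)$, $\varrho\to1-$; * iii) $f^{[r-1]}\in\mathcal S^pH^1_\omega$. Then: 1. i) and ii) are equivalent. 2. Each of i), ii) implies iii); if $r\ge2$ and $f$ is a trigonometric polynomial with $\widehat f(\mathbf k)=0$ for all $|\mathbf k|_1\ge r$, this is asserted under the additional assumption $\delta=O(\omega(\delta))$, $\delta\to0+$. 3. If $\widehat f(\mathbf k)=0$ for all $\mathbf k\notin\mathbb Z_+^d\cup\mathbb Z_-^d$ (the integer vectors with all coordinates nonnegative, respectively all negative), then iii) implies i) and ii);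 so, with the proviso in 2, all three conditions are equivalent. 4. If $f^{[r]}$ is the Fourier series of some $g\in L(\mathbb T^d)$, then ii) is equivalent to the same condition for the Poisson integral of the function $g$; if $f^{[r-1]}$ is the Fourier series of some $g\in L(\mathbb T^d)$, then iii) is equivalent to $g\in\mathcal S^pH^1_\omega$, with the increments $g-g(\cdot-h)$ formed for the function $g$. If $p\le2$ or $r=1$, then each of i), ii) implies that $f^{[r-1]}$ is the Fourier series of a function in $L(\mathbb T^d)$. -/

import Mathlib

open MeasureTheory Filter Topology Asymptotics

noncomputable section

namespace SpApprox

instance factTwoPiPos : Fact ((0 : ℝ) < 2 * Real.pi) := ⟨Real.two_pi_pos⟩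

/-- The torus `(ℝ / 2πℤ)^d`; functions on it are the functions of `d` real variables that are
`2π`-periodic in each variable. Its measure `volume` is Lebesgue measure of total mass `(2π)^d`.
The space `L(𝕋^d)` consists of the `f : Torus d → ℂ` with `Integrable f`. -/
abbrev Torus (d : ℕ) : Type := Fin d → AddCircle (2 * Real.pi)

/-- Formal trigonometric series `∑ c_k e^{i(k,x)}`, given by their coefficients. -/
abbrev TrigSeries (d : ℕ) : Type := (Fin d → ℤ) → ℂ

/-- The exponential `e^{i(k,x)}`. -/
def expo {d : ℕ} (k : Fin d → ℤ) (x : Torus d) : ℂ := ∏ j, fourier (k j) (x j)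

/-- The Fourier coefficients (the Fourier series) of a function:
`(2π)^{-d} ∫ f(x) e^{-i(k,x)} dx`. -/
def fourierSeries {d : ℕ} (f : Torus d → ℂ) : TrigSeries d :=
  fun k => ((2 * Real.pi : ℝ) : ℂ)⁻¹ ^ d * ∫ x, f x * expo (-k) x

/-- `|k|₁ = |k_1| + ... + |k_d|`. -/
def l1 {d : ℕ} (k : Fin d → ℤ) : ℕ := ∑ j, (k j).natAbs

/-- The finite set of all `k` with `|k|₁ = ν`. -/
def shell (d ν : ℕ) : Finset (Fin d → ℤ) :=
  (Fintype.piFinset fun _ => Finset.Icc (-(ν : ℤ)) (ν : ℤ)).filter fun k => l1 k = ν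

/-- The block `∑_{|k|₁ = ν} c_k e^{i(k,x)}` of a series. -/
def block {d : ℕ} (c : TrigSeries d) (ν : ℕ) (x : Torus d) : ℂ :=
  ∑ k ∈ shell d ν, c k * expo k x

/-- The norm `(∑ |c_k|^p)^{1/p}` of `𝒮^p`, with value `∞` off the space. The norm of a function
is the norm of its Fourier series. -/
def spNorm {d : ℕ} (p : ℝ) (c : TrigSeries d) : ENNReal :=
  (∑' k, ENNReal.ofReal (‖c k‖ ^ p)) ^ (1 / p)

/-- The triangular partial sum of the Fourier series of `f`, of degree less than `n`. -/
def partialSum {d : ℕ} (n : ℕ) (f : Torus d → ℂ) (x : Torus d) : ℂ :=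
  ∑ ν ∈ Finset.range n, block (fourierSeries f) ν x

/-- The multipliers `∑_{k<r} C(ν,k) (1-ρ)^k ρ^{ν-k}`; only used for `ν ≥ r`. -/
def tapCoeff (r ν : ℕ) (ρ : ℝ) : ℝ :=
  ∑ k ∈ Finset.range r, (ν.choose k : ℝ) * (1 - ρ) ^ k * ρ ^ (ν - k)

/-- The triangular Taylor–Abel–Poisson mean of `f`: the partial sum of degree `r - 1` plus
`∑_{ν ≥ r} λ_{ν,r}(ρ) H_ν(f)`. -/
def tapMean {d : ℕ} (r : ℕ) (ρ : ℝ) (f : Torus d → ℂ) (x : Torus d) : ℂ :=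
  partialSum r f x +
    ∑' m : ℕ, (tapCoeff r (m + r) ρ : ℂ) * block (fourierSeries f) (m + r) x

/-- `g` is a `ψ`-derivative of `c`: `c = ∑_{ψ(k) = 0} c_k e^{i(k,x)} + ∑ ψ(k) g_k e^{i(k,x)}`. -/
def IsPsiDeriv {d : ℕ} (ψ : (Fin d → ℤ) → ℂ) (c g : TrigSeries d) : Prop :=
  ∀ k, c k = (if ψ k = 0 then c k else 0) + ψ k * g k

/-- The `ψ`-derivative of a series. A `ψ`-derivative is determined up to its coefficients on the
zero set of `ψ`, and these are taken to be `0`. -/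
def psiDeriv {d : ℕ} (ψ : (Fin d → ℤ) → ℂ) (c : TrigSeries d) : TrigSeries d :=
  fun k => if ψ k = 0 then 0 else c k / ψ k

theorem isPsiDeriv_psiDeriv {d : ℕ} (ψ : (Fin d → ℤ) → ℂ) (c : TrigSeries d) :
    IsPsiDeriv ψ c (psiDeriv ψ c) := by
  intro k
  by_cases h : ψ k = 0
  · simp [psiDeriv, h]
  · simp [psiDeriv, h, mul_div_cancel₀]

/-- The system `ψ(k) = 0` for `|k|₁ < r` and `ψ(k) = (ν - r)! / ν!` for `|k|₁ = ν ≥ r`. -/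
def radialPsi {d : ℕ} (r : ℕ) (k : Fin d → ℤ) : ℂ :=
  if l1 k < r then 0 else ((l1 k - r).factorial : ℂ) / ((l1 k).factorial : ℂ)

/-- The derivative `f^{[r]}`, as a trigonometric series. -/
def radialDeriv {d : ℕ} (r : ℕ) (f : Torus d → ℂ) : TrigSeries d :=
  psiDeriv (radialPsi r) (fourierSeries f)

/-- The Poisson integral of a trigonometric series, `∑_ν ρ^ν ∑_{|k|₁ = ν} c_k e^{i(k,x)}`. -/
def poissonSeries {d : ℕ} (c : TrigSeries d) (ρ : ℝ) (x : Torus d) : ℂ :=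
  ∑' ν : ℕ, ((ρ ^ ν : ℝ) : ℂ) * block c ν x

/-- The multiple Poisson kernel, with all radii equal to `ρ`. -/
def poissonKernel {d : ℕ} (ρ : ℝ) (t : Torus d) : ℝ :=
  ∏ j, (1 - ρ ^ 2) / (1 - 2 * ρ * Real.Angle.cos (t j) + ρ ^ 2)

/-- The Poisson integral of a function. -/
def poissonIntegral {d : ℕ} (g : Torus d → ℂ) (ρ : ℝ) (x : Torus d) : ℂ :=
  ((2 * Real.pi : ℝ) : ℂ)⁻¹ ^ d * ∫ t, g (x + t) * (poissonKernel ρ t : ℂ)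

/-- The diagonal vector `(h, ..., h)`. -/
def diag (d : ℕ) (h : ℝ) : Torus d := fun _ => (h : AddCircle (2 * Real.pi))

/-- The first modulus of smoothness of a function, `sup_{|h| ≤ t} ‖g - g(· - h)‖`, where the
increment `h` is a number and is subtracted from all the variables. -/
def modulus {d : ℕ} (p : ℝ) (g : Torus d → ℂ) (t : ℝ) : ENNReal :=
  ⨆ (h : ℝ) (_ : |h| ≤ t), spNorm p (fourierSeries fun x => g x - g (x - diag d h))

/-- The first modulus of smoothness of a trigonometric series; the translate of
`∑ c_k e^{i(k,x)}` has the coefficients `c_k e^{-i(k,(h,...,h))}`. -/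
def modulusSeries {d : ℕ} (p : ℝ) (c : TrigSeries d) (t : ℝ) : ENNReal :=
  ⨆ (h : ℝ) (_ : |h| ≤ t), spNorm p fun k => c k - c k * expo k (-diag d h)

/-- `g ∈ 𝒮^p H^1_ω`, for a function `g`. -/
def InSpH {d : ℕ} (p : ℝ) (ω : ℝ → ℝ) (g : Torus d → ℂ) : Prop :=
  spNorm p (fourierSeries g) < ⊤ ∧
    ∃ C : ℝ, ∀ᶠ δ in 𝓝[>] (0 : ℝ), modulus p g δ ≤ ENNReal.ofReal (C * ω δ)

/-- `c ∈ 𝒮^p H^1_ω`, for a trigonometric series `c`. -/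
def SeriesInSpH {d : ℕ} (p : ℝ) (ω : ℝ → ℝ) (c : TrigSeries d) : Prop :=
  spNorm p c < ⊤ ∧
    ∃ C : ℝ, ∀ᶠ δ in 𝓝[>] (0 : ℝ), modulusSeries p c δ ≤ ENNReal.ofReal (C * ω δ)

/-- `‖F(ρ,·)‖_{𝒮^p} = O(φ(ρ))` as `ρ → 1-`. -/
def SpBigO {d : ℕ} (p : ℝ) (F : ℝ → Torus d → ℂ) (φ : ℝ → ℝ) : Prop :=
  ∃ C : ℝ, ∀ᶠ ρ in 𝓝[<] (1 : ℝ),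
    spNorm p (fourierSeries (F ρ)) ≤ ENNReal.ofReal (C * φ ρ)

/-- Conditions 1)–4) on a majorant on `[0,1]`. -/
structure IsMajorant (ω : ℝ → ℝ) : Prop where
  continuousOn : ContinuousOn ω (Set.Icc 0 1)
  monotoneOn : MonotoneOn ω (Set.Icc 0 1)
  ne_zero : ∀ δ ∈ Set.Ioc (0 : ℝ) 1, ω δ ≠ 0
  tendsto_zero : Tendsto ω (𝓝[>] 0) (𝓝 0)

/-- Bari's condition `∑_{v>n} ω(1/v)/v = O(ω(1/n))`. -/
def BariCondition (ω : ℝ → ℝ) : Prop :=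
  Summable (fun v : ℕ => 1 / (v : ℝ) * ω (1 / (v : ℝ))) ∧
    (fun n : ℕ => ∑' m : ℕ, 1 / ((n + 1 + m : ℕ) : ℝ) * ω (1 / ((n + 1 + m : ℕ) : ℝ)))
      =O[atTop] fun n : ℕ => ω (1 / (n : ℝ))

/-- The Fourier coefficients vanish off `ℤ_+^d ∪ ℤ_-^d`, the set of integer vectors that have
all their coordinates nonnegative or all negative. -/
def SpectrumInY {d : ℕ} (f : Torus d → ℂ) : Prop :=
  ∀ k : Fin d → ℤ, ¬ ((∀ j, 0 ≤ k j) ∨ (∀ j, k j < 0)) → fourierSeries f k = 0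

/-- `‖f - A_{ρ,r}(f)‖ = O((1-ρ)^{r-1} ω(1-ρ))`. -/
def ApproxRate {d : ℕ} (p : ℝ) (r : ℕ) (ω : ℝ → ℝ) (f : Torus d → ℂ) : Prop :=
  SpBigO p (fun ρ x => f x - tapMean r ρ f x) fun ρ => (1 - ρ) ^ (r - 1) * ω (1 - ρ)

/-- `‖P(f^{[r]})(ρ,·)‖ = O(ω(1-ρ)/(1-ρ))`. -/
def PoissonRate {d : ℕ} (p : ℝ) (r : ℕ) (ω : ℝ → ℝ) (f : Torus d → ℂ) : Prop :=
  SpBigO p (poissonSeries (radialDeriv r f)) fun ρ => ω (1 - ρ) / (1 - ρ)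

end SpApprox

end

/-
Put `δ = 1 - ρ`, `ν = |k|₁`, `r = q + 1`, and let `‖·‖` be the norm of `𝒮^p`. On the Fourier
coefficients `c_k` of `f`, condition i) bounds `‖(1 - λ_{ν,r}(1 - δ)) c_k‖`, and ii) bounds
`δ ‖ν!/(ν - r)! (1 - δ)^ν c_k‖`. The number `1 - λ_{ν,r}(ρ)` is the tail
`∑_{k ≥ r} C(ν,k) (1 - ρ)^k ρ^(ν - k)`, whose first term gives i) ⇒ ii). In the other direction,
`λ_{ν,r}` has the derivative `r C(ν,r) (1 - ρ)^q ρ^(ν - r)` and the value `1` at `ρ = 1`;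
integrating over the intervals between `1 - δ/2^j` and `1 - δ/2^(j+1)` bounds
`1 - λ_{ν,r}(1 - δ)` by the sum over `j` of the quantities of ii) at `δ/2^j`, and Minkowski's
inequality together with Bari's condition in the dyadic form `∑_j ω(δ/2^j) = O(ω(δ))` turns ii)
into i).

The increment by `h` multiplies `c_k` by `1 - e^{-ih(k_1 + ⋯ + k_d)}`, of modulus at most
`min(2, |h| ν)`. For `|h| ≤ δ` this is at most `3 (1 - (1 - δ)^(ν - q)) + q δ`: the first part is
controlled by ii) as in ii) ⇒ i) with `r = 1`, and the second is the source of the proviso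
`δ = O(ω(δ))`. When `ν = O(|k_1 + ⋯ + k_d|)` on the spectrum, one of the increments by `δ/2^j`
has modulus comparable with `min(1, δ ν) ≥ δ ν (1 - δ)^ν`, and summation over `j` gives
iii) ⇒ ii).
-/

open scoped ENNReal NNReal

noncomputable section

namespace SpApprox

section Norm

theorem eLpNorm_tsum_le {α : Type*} [MeasurableSpace α] {μ : Measure α} {q : ℝ≥0∞} (hq : 1 ≤ q)
    {u : ℕ → α → ℝ≥0∞} (hu : ∀ j, AEMeasurable (u j) μ) :
    eLpNorm (fun x => ∑' j, u j x) q μ ≤ ∑' j, eLpNorm (u j) q μ := by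
  rcases eq_or_ne q ∞ with rfl | hq'
  · refine eLpNormEssSup_le_of_ae_enorm_bound ?_
    filter_upwards [ae_all_iff.2 fun j => ae_le_eLpNormEssSup (f := u j)] with x hx
    exact ENNReal.tsum_le_tsum fun j => (hx j).trans eLpNorm_exponent_top.ge
  have hq0 : q ≠ 0 := (zero_lt_one.trans_le hq).ne'
  have hpos : 0 < q.toReal := ENNReal.toReal_pos hq0 hq'
  have partial_le (n : ℕ) : ∫⁻ x, (∑ j ∈ Finset.range n, u j x) ^ q.toReal ∂μ ≤
      (∑' j, eLpNorm (u j) q μ) ^ q.toReal := by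
    have := (eLpNorm_sum_le (s := Finset.range n)
      (fun j _ => (hu j).aestronglyMeasurable) hq).trans (ENNReal.sum_le_tsum _)
    rw [eLpNorm_eq_lintegral_rpow_enorm_toReal hq0 hq', one_div,
      ENNReal.rpow_inv_le_iff hpos] at this
    simpa only [enorm_eq_self, Finset.sum_apply] using this
  rw [eLpNorm_eq_lintegral_rpow_enorm_toReal hq0 hq', one_div, ENNReal.rpow_inv_le_iff hpos]
  refine le_of_tendsto' (lintegral_tendsto_of_tendsto_of_monotone (fun n =>
    (Finset.aemeasurable_fun_sum _ fun j _ => hu j).pow_const q.toReal) ?_ ?_) partial_le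
  · exact ae_of_all _ fun x m n hmn => by dsimp only; gcongr
  · exact ae_of_all _ fun x => (ENNReal.tendsto_nat_tsum fun j => u j x).ennrpow_const _

variable {d : ℕ} {p : ℝ}

theorem spNorm_eq_eLpNorm (hp : 0 < p) (c : TrigSeries d) :
    spNorm p c = eLpNorm c (ENNReal.ofReal p) Measure.count := by
  rw [eLpNorm_eq_lintegral_rpow_enorm_toReal (by simpa using hp) ENNReal.ofReal_ne_top,
    lintegral_count, ENNReal.toReal_ofReal hp.le, spNorm]
  simp_rw [← ENNReal.ofReal_rpow_of_nonneg (norm_nonneg _) hp.le, ofReal_norm]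

theorem spNorm_le_mul (hp : 0 < p) {b c : TrigSeries d} {C : ℝ}
    (h : ∀ k, ‖b k‖ ≤ C * ‖c k‖) : spNorm p b ≤ ENNReal.ofReal C * spNorm p c := by
  rw [spNorm_eq_eLpNorm hp, spNorm_eq_eLpNorm hp]
  exact eLpNorm_le_mul_eLpNorm_of_ae_le_mul (ae_of_all _ h) _

theorem mul_spNorm_le_mul (hp : 0 < p) {b c : TrigSeries d} {s t : ℝ} (hs : 0 < s)
    (h : ∀ k, s * ‖b k‖ ≤ t * ‖c k‖) :
    .ofReal s * spNorm p b ≤ ENNReal.ofReal t * spNorm p c := by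
  have le_div (k : Fin d → ℤ) : ‖b k‖ ≤ t / s * ‖c k‖ := by
    rw [div_mul_eq_mul_div, le_div_iff₀' hs]
    exact h k
  grw [spNorm_le_mul hp le_div, ← mul_assoc, ← ENNReal.ofReal_mul hs.le, mul_div_cancel₀ t hs.ne']

theorem spNorm_le_tsum (hp : 1 ≤ p) {c : TrigSeries d} {t : ℕ → ℝ} {b : ℕ → TrigSeries d}
    (h : ∀ k, ‖c k‖ₑ ≤ ∑' j, ENNReal.ofReal (t j) * ‖b j k‖ₑ) :
    spNorm p c ≤ ∑' j, ENNReal.ofReal (t j) * spNorm p (b j) := by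
  have hp0 : 0 < p := zero_lt_one.trans_le hp
  simp_rw [spNorm_eq_eLpNorm hp0]
  calc eLpNorm c (.ofReal p) .count
      ≤ eLpNorm (fun k => ∑' j, ENNReal.ofReal (t j) * ‖b j k‖ₑ) (.ofReal p) .count :=
        eLpNorm_mono_enorm fun k => h k
    _ ≤ ∑' j, eLpNorm (fun k => ENNReal.ofReal (t j) * ‖b j k‖ₑ) (.ofReal p) .count :=
        eLpNorm_tsum_le (ENNReal.one_le_ofReal.2 hp) fun j => Measurable.of_discrete.aemeasurable
    _ ≤ _ := ENNReal.tsum_le_tsum fun j =>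
        eLpNorm_le_mul_eLpNorm_of_ae_le_mul'' _ Measurable.of_discrete.aestronglyMeasurable
          (ae_of_all _ fun k => le_rfl)

theorem spNorm_le_add (hp : 1 ≤ p) {a b c : TrigSeries d} (h : ∀ k, ‖a k‖ₑ ≤ ‖b k‖ₑ + ‖c k‖ₑ) :
    spNorm p a ≤ spNorm p b + spNorm p c := by
  have hp0 : 0 < p := zero_lt_one.trans_le hp
  simp_rw [spNorm_eq_eLpNorm hp0]
  calc eLpNorm a (.ofReal p) .count
      ≤ eLpNorm ((‖b ·‖ₑ) + (‖c ·‖ₑ)) (.ofReal p) .count := eLpNorm_mono_enorm fun k => h k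
    _ ≤ eLpNorm (‖b ·‖ₑ) (.ofReal p) .count + eLpNorm (‖c ·‖ₑ) (.ofReal p) .count :=
        eLpNorm_add_le (by fun_prop) (by fun_prop) (ENNReal.one_le_ofReal.2 hp)
    _ = _ := by simp only [eLpNorm_enorm]

theorem enorm_le_spNorm (hp : 0 < p) (c : TrigSeries d) (k : Fin d → ℤ) : ‖c k‖ₑ ≤ spNorm p c :=
  spNorm_eq_eLpNorm hp c ▸ enorm_le_eLpNorm_count c k (by simpa using hp)

theorem spNorm_lt_top_of_finite_support (hp : 0 < p) {c : TrigSeries d}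
    (hc : (Function.support c).Finite) : spNorm p c < ⊤ := by
  refine ENNReal.rpow_lt_top_of_nonneg (by positivity) ?_
  rw [tsum_eq_sum (s := hc.toFinset) fun k hk => by
    simp [show c k = 0 by simpa using hk, hp.ne']]
  simp

end Norm

section EBigO

variable {α : Type*} {l : Filter α} {M N Φ : α → ℝ≥0∞}

/-- `N = O(Φ)` along `l`, for functions with values in `[0, ∞]`: `Asymptotics.IsBigO` asks for
norms, which `ℝ≥0∞` does not have. The constant is finite. -/
def EBigO (l : Filter α) (N Φ : α → ℝ≥0∞) : Prop := ∃ C : ℝ≥0, ∀ᶠ x in l, N x ≤ C * Φ x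

theorem EBigO.of_le {C : ℝ≥0∞} (hC : C ≠ ∞) (h : ∀ᶠ x in l, N x ≤ C * Φ x) : EBigO l N Φ :=
  ⟨C.toNNReal, by rwa [ENNReal.coe_toNNReal hC]⟩

theorem EBigO.trans (h : EBigO l M N) (h' : EBigO l N Φ) : EBigO l M Φ := by
  obtain ⟨C, hC⟩ := h
  obtain ⟨D, hD⟩ := h'
  refine ⟨C * D, ?_⟩
  filter_upwards [hC, hD] with x hx hx'
  grw [hx, hx', ENNReal.coe_mul, mul_assoc]

theorem EBigO.add (h : EBigO l M Φ) (h' : EBigO l N Φ) : EBigO l (fun x => M x + N x) Φ := by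
  obtain ⟨C, hC⟩ := h
  obtain ⟨D, hD⟩ := h'
  refine ⟨C + D, ?_⟩
  filter_upwards [hC, hD] with x hx hx'
  grw [hx, hx', ENNReal.coe_add, add_mul]

theorem EBigO.const_mul {C : ℝ≥0∞} (hC : C ≠ ∞) (h : EBigO l N Φ) :
    EBigO l (fun x => C * N x) Φ :=
  (EBigO.of_le hC (Eventually.of_forall fun _ => le_rfl)).trans h

theorem EBigO.mul_left (h : EBigO l N Φ) (w : α → ℝ≥0∞) :
    EBigO l (fun x => w x * N x) fun x => w x * Φ x := by
  obtain ⟨C, hC⟩ := h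
  refine ⟨C, hC.mono fun x hx => ?_⟩
  calc w x * N x ≤ w x * (C * Φ x) := by gcongr
    _ = C * (w x * Φ x) := mul_left_comm ..

theorem eBigO_congr {N' Φ' : α → ℝ≥0∞} (hN : N =ᶠ[l] N') (hΦ : Φ =ᶠ[l] Φ') :
    EBigO l N Φ ↔ EBigO l N' Φ' :=
  exists_congr fun C => eventually_congr <| by
    filter_upwards [hN, hΦ] with x hNx hΦx
    rw [hNx, hΦx]

theorem eBigO_mul_left_iff {w : α → ℝ} (hw : ∀ᶠ x in l, 0 < w x) :
    EBigO l (fun x => .ofReal (w x) * N x) (fun x => .ofReal (w x) * Φ x) ↔ EBigO l N Φ := by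
  refine exists_congr fun C => eventually_congr (hw.mono fun x hx => ?_)
  rw [mul_left_comm, ENNReal.mul_le_mul_iff_right (by simpa using hx) ENNReal.ofReal_ne_top]

theorem eBigO_ofReal_iff {φ : α → ℝ} (hφ : ∀ᶠ x in l, 0 ≤ φ x) :
    EBigO l N (fun x => .ofReal (φ x)) ↔ ∃ C : ℝ, ∀ᶠ x in l, N x ≤ .ofReal (C * φ x) := by
  constructor
  · rintro ⟨C, hC⟩
    refine ⟨C, hC.mono fun x hx => ?_⟩
    rwa [ENNReal.ofReal_mul C.coe_nonneg, ENNReal.ofReal_coe_nnreal]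
  · rintro ⟨C, hC⟩
    refine ⟨C.toNNReal, ?_⟩
    filter_upwards [hC, hφ] with x hx hx'
    rwa [ENNReal.ofReal_mul' hx'] at hx

theorem eBigO_ofReal_ofReal_of_isBigO {φ ψ : α → ℝ} (hψ : ∀ᶠ x in l, 0 ≤ ψ x) (h : φ =O[l] ψ) :
    EBigO l (fun x => .ofReal (φ x)) fun x => .ofReal (ψ x) := by
  obtain ⟨C, hC⟩ := h.bound
  refine (eBigO_ofReal_iff hψ).2 ⟨C, ?_⟩
  filter_upwards [hC, hψ] with x hx hx'
  rw [Real.norm_of_nonneg hx'] at hx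
  exact ENNReal.ofReal_le_ofReal ((Real.le_norm_self _).trans hx)

end EBigO

section Dyadic

theorem eventually_nhdsGT_zero_forall_le {P : ℝ → Prop} (h : ∀ᶠ δ in 𝓝[>] (0 : ℝ), P δ) :
    ∀ᶠ δ in 𝓝[>] (0 : ℝ), ∀ s, 0 < s → s ≤ δ → P s := by
  obtain ⟨ε, hε, hP⟩ := mem_nhdsGT_iff_exists_Ioo_subset.1 h
  filter_upwards [Ioo_mem_nhdsGT (Set.mem_Ioi.1 hε)] with δ hδ s hs hsδ
  exact hP ⟨hs, hsδ.trans_lt hδ.2⟩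

/-- Bari's condition in dyadic form: `∑_j Φ(δ / 2^j) = O(Φ(δ))` as `δ → 0+`. -/
def DyadicBari (Φ : ℝ → ℝ≥0∞) : Prop := EBigO (𝓝[>] 0) (fun δ => ∑' j : ℕ, Φ (δ / 2 ^ j)) Φ

theorem EBigO.tsum_dyadic {N Φ : ℝ → ℝ≥0∞} (h : EBigO (𝓝[>] 0) N Φ) (hΦ : DyadicBari Φ) :
    EBigO (𝓝[>] 0) (fun δ => ∑' j : ℕ, N (δ / 2 ^ j)) Φ := by
  obtain ⟨C, hC⟩ := h
  refine EBigO.trans ⟨C, ?_⟩ hΦ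
  filter_upwards [eventually_nhdsGT_zero_forall_le hC, self_mem_nhdsWithin] with δ hδ hpos
  rw [Set.mem_Ioi] at hpos
  rw [← ENNReal.tsum_mul_left]
  exact ENNReal.tsum_le_tsum fun j =>
    hδ _ (by positivity) (div_le_self hpos.le (one_le_pow₀ one_le_two))

theorem sum_range_two_pow_smul_le_tsum {f : ℕ → ℝ} (hf : ∀ ⦃m n⦄, 1 < m → m ≤ n → f n ≤ f m)
    (hf0 : ∀ ⦃n⦄, 1 < n → 0 ≤ f n) (hs : Summable f) {n : ℕ} (hn : 0 < n) (J : ℕ) :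
    ∑ j ∈ Finset.range J, ((2 ^ j * n : ℕ) : ℝ) * f (2 ^ (j + 1) * n) ≤ ∑' i, f (n + 1 + i) := by
  have hmono : Monotone fun j => 2 ^ j * n := fun i j hij => by dsimp only; gcongr; exact one_le_two
  have condensed := Finset.sum_schlomilch_le' hf (fun j => by positivity) hmono J
  simp only [pow_zero, one_mul, nsmul_eq_mul] at condensed
  calc ∑ j ∈ Finset.range J, ((2 ^ j * n : ℕ) : ℝ) * f (2 ^ (j + 1) * n)
      = ∑ j ∈ Finset.range J, ((2 ^ (j + 1) * n - 2 ^ j * n : ℕ) : ℝ) * f (2 ^ (j + 1) * n) := by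
        refine Finset.sum_congr rfl fun j _ => ?_
        congr 2
        rw [pow_succ]; lia
    _ ≤ ∑ v ∈ Finset.Ico (n + 1) (2 ^ J * n + 1), f v := condensed
    _ = ∑ i ∈ Finset.range (2 ^ J * n + 1 - (n + 1)), f (n + 1 + i) :=
        Finset.sum_Ico_eq_sum_range ..
    _ ≤ ∑' i, f (n + 1 + i) :=
        (hs.comp_injective (add_right_injective _)).sum_le_tsum _ fun i _ => hf0 (by lia)

variable {ω : ℝ → ℝ}

theorem sum_range_dyadic_le_tsum (hpos : ∀ δ ∈ Set.Ioc 0 1, 0 < ω δ)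
    (hmono : MonotoneOn ω (Set.Ioc 0 1)) (hs : Summable fun v : ℕ => 1 / (v : ℝ) * ω (1 / v))
    {n : ℕ} (hn : 0 < n) (J : ℕ) :
    ∑ j ∈ Finset.range J, ω (1 / (2 ^ (j + 1) * n)) ≤
      2 * ∑' m : ℕ, 1 / ((n + 1 + m : ℕ) : ℝ) * ω (1 / ((n + 1 + m : ℕ) : ℝ)) := by
  have mem {v : ℕ} (hv : 1 < v) : 1 / (v : ℝ) ∈ Set.Ioc 0 1 :=
    ⟨by positivity, div_le_one_of_le₀ (by exact_mod_cast hv.le) (by positivity)⟩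
  have anti ⦃u v : ℕ⦄ (hu : 1 < u) (huv : u ≤ v) :
      1 / (v : ℝ) * ω (1 / v) ≤ 1 / (u : ℝ) * ω (1 / u) := by
    have hle : 1 / (v : ℝ) ≤ 1 / u := by gcongr
    exact mul_le_mul hle (hmono (mem (hu.trans_le huv)) (mem hu) hle)
      (hpos _ (mem (hu.trans_le huv))).le (by positivity)
  have hnonneg ⦃v : ℕ⦄ (hv : 1 < v) : 0 ≤ 1 / (v : ℝ) * ω (1 / v) :=
    mul_nonneg (by positivity) (hpos _ (mem hv)).le
  grw [← sum_range_two_pow_smul_le_tsum anti hnonneg hs hn J, Finset.mul_sum]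
  refine (Finset.sum_congr rfl fun j _ => ?_).le
  push_cast
  field_simp
  ring

theorem tsum_dyadic_le (hpos : ∀ δ ∈ Set.Ioc 0 1, 0 < ω δ) (hmono : MonotoneOn ω (Set.Ioc 0 1))
    {δ A : ℝ} (hδ : δ ∈ Set.Ioc 0 1) {n : ℕ} (hn0 : 0 < n) (hn : n * δ ≤ 2)
    (hA : ∀ J, ∑ j ∈ Finset.range J, ω (1 / (2 ^ (j + 1) * n)) ≤ A) :
    ∑' j : ℕ, ENNReal.ofReal (ω (δ / 2 ^ j)) ≤ .ofReal (2 * ω δ + A) := by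
  have mem (j : ℕ) : δ / 2 ^ j ∈ Set.Ioc 0 1 :=
    ⟨by have := hδ.1; positivity, (div_le_self hδ.1.le (one_le_pow₀ one_le_two)).trans hδ.2⟩
  have tail_le (j : ℕ) : ω (δ / 2 ^ (j + 2)) ≤ ω (1 / (2 ^ (j + 1) * n)) := by
    have hle : δ / 2 ^ (j + 2) ≤ 1 / (2 ^ (j + 1) * n) := by
      rw [div_le_div_iff₀ (by positivity) (by positivity)]
      linear_combination 2 ^ (j + 1) * hn
    refine hmono (mem _) ⟨by positivity, div_le_one_of_le₀ ?_ (by positivity)⟩ hle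
    exact one_le_mul_of_one_le_of_one_le (one_le_pow₀ one_le_two) (by exact_mod_cast hn0)
  have second_le : ω (δ / 2 ^ 1) ≤ ω δ :=
    hmono (mem 1) hδ (div_le_self hδ.1.le (one_le_pow₀ one_le_two))
  refine ENNReal.tsum_le_of_sum_range_le fun J => ?_
  rw [← ENNReal.ofReal_sum_of_nonneg fun j _ => (hpos _ (mem j)).le]
  refine ENNReal.ofReal_le_ofReal ?_
  calc ∑ j ∈ Finset.range J, ω (δ / 2 ^ j)
      ≤ ∑ j ∈ Finset.range (J + 2), ω (δ / 2 ^ j) :=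
        Finset.sum_le_sum_of_subset_of_nonneg (Finset.range_mono (by lia))
          fun j _ _ => (hpos _ (mem j)).le
    _ = ∑ j ∈ Finset.range J, ω (δ / 2 ^ (j + 2)) + ω (δ / 2 ^ 1) + ω (δ / 2 ^ 0) := by
        rw [Finset.sum_range_succ', Finset.sum_range_succ']
    _ ≤ A + ω δ + ω δ := by
        grw [second_le, ← hA J, Finset.sum_le_sum fun j _ => tail_le j]
        simp
    _ = _ := by ring

theorem BariCondition.dyadicBari (hpos : ∀ δ ∈ Set.Ioc 0 1, 0 < ω δ)
    (hmono : MonotoneOn ω (Set.Ioc 0 1)) (hB : BariCondition ω) :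
    DyadicBari fun δ => .ofReal (ω δ) := by
  obtain ⟨hs, hO⟩ := hB
  obtain ⟨C, hC0, hC⟩ := hO.exists_nonneg
  have ceil_tendsto : Tendsto (fun δ : ℝ => ⌈δ⁻¹⌉₊) (𝓝[>] 0) atTop :=
    tendsto_nat_ceil_atTop.comp tendsto_inv_nhdsGT_zero
  refine (eBigO_ofReal_iff ?_).2 ⟨2 + 2 * C, ?_⟩
  · filter_upwards [Ioc_mem_nhdsGT one_pos] with δ hδ using (hpos δ hδ).le
  filter_upwards [Ioc_mem_nhdsGT one_pos, ceil_tendsto.eventually hC.bound] with δ hδ hCδ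
  set n := ⌈δ⁻¹⌉₊
  have hδ0 : 0 < δ := hδ.1
  have hn0 : 0 < n := Nat.ceil_pos.2 (inv_pos.2 hδ0)
  have hn_ge : 1 / (n : ℝ) ≤ δ := by
    rw [one_div]; exact inv_le_of_inv_le₀ hδ0 (Nat.le_ceil _)
  have hn_le : n * δ ≤ 2 := by
    have : (n : ℝ) < δ⁻¹ + 1 := Nat.ceil_lt_add_one (by positivity)
    calc n * δ ≤ (δ⁻¹ + 1) * δ := by gcongr
      _ = 1 + δ := by field_simp
      _ ≤ 2 := by linarith [hδ.2]
  have hmem : 1 / (n : ℝ) ∈ Set.Ioc 0 1 := ⟨by positivity, hn_ge.trans hδ.2⟩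
  rw [Real.norm_of_nonneg (hpos _ hmem).le] at hCδ
  refine (tsum_dyadic_le hpos hmono hδ hn0 hn_le (A := 2 * (C * ω δ)) fun J => ?_).trans_eq ?_
  · grw [sum_range_dyadic_le_tsum hpos hmono hs hn0 J, Real.le_norm_self (∑' m : ℕ, _), hCδ,
      hmono hmem hδ hn_ge]
  · congr 1; ring

end Dyadic

section TapCoeff

theorem pow_sub_le_mul_pow {c t : ℝ} (ht0 : 0 ≤ t) (ht1 : t ≤ 1) (hct : 1 ≤ c * t) (ν q : ℕ) :
    t ^ (ν - q) ≤ c ^ q * t ^ ν := by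
  calc t ^ (ν - q) ≤ t ^ (ν - q) * (c * t) ^ q :=
        le_mul_of_one_le_right (pow_nonneg ht0 _) (one_le_pow₀ hct)
    _ = (c * t) ^ q * t ^ (ν - q) := mul_comm ..
    _ = c ^ q * t ^ (ν - q + q) := by rw [mul_pow, pow_add]; ring
    _ ≤ c ^ q * t ^ ν := by
        have hc : 0 ≤ c := by
          by_contra! h
          nlinarith
        exact mul_le_mul_of_nonneg_left (pow_le_pow_of_le_one ht0 ht1 (by lia)) (pow_nonneg hc q)

theorem tapCoeff_of_lt {r ν : ℕ} (h : ν < r) (ρ : ℝ) : tapCoeff r ν ρ = 1 := by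
  have binomial := add_pow (1 - ρ) ρ ν
  rw [sub_add_cancel, one_pow] at binomial
  rw [tapCoeff, ← Finset.sum_subset (Finset.range_subset_range.2 h)]
  · exact (Finset.sum_congr rfl fun k _ => by ring).trans binomial.symm
  · intro k _ hk
    rw [Finset.mem_range, not_lt] at hk
    rw [Nat.choose_eq_zero_of_lt (by lia), Nat.cast_zero, zero_mul, zero_mul]

theorem tapCoeff_succ (r ν : ℕ) (ρ : ℝ) :
    tapCoeff (r + 1) ν ρ = tapCoeff r ν ρ + ν.choose r * (1 - ρ) ^ r * ρ ^ (ν - r) :=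
  Finset.sum_range_succ ..

theorem tapCoeff_one_left (ν : ℕ) (ρ : ℝ) : tapCoeff 1 ν ρ = ρ ^ ν := by
  simp [tapCoeff]

theorem tapCoeff_succ_one_right (q ν : ℕ) : tapCoeff (q + 1) ν 1 = 1 := by
  simp [tapCoeff, Finset.sum_range_succ']

theorem tapCoeff_le_one (r ν : ℕ) {ρ : ℝ} (h0 : 0 ≤ ρ) (h1 : ρ ≤ 1) : tapCoeff r ν ρ ≤ 1 := by
  have := sub_nonneg.2 h1
  rw [← tapCoeff_of_lt (show ν < max r (ν + 1) by lia) ρ]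
  exact Finset.sum_le_sum_of_subset_of_nonneg (Finset.range_subset_range.2 (le_max_left _ _))
    fun k _ _ => by positivity

theorem choose_mul_le_one_sub_tapCoeff (r ν : ℕ) {ρ : ℝ} (h0 : 0 ≤ ρ) (h1 : ρ ≤ 1) :
    ν.choose r * (1 - ρ) ^ r * ρ ^ (ν - r) ≤ 1 - tapCoeff r ν ρ := by
  linarith [tapCoeff_le_one (r + 1) ν h0 h1, tapCoeff_succ r ν ρ]

theorem continuous_tapCoeff (r ν : ℕ) : Continuous (tapCoeff r ν) := by
  unfold tapCoeff
  fun_prop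

theorem hasDerivAt_tapCoeff_succ (q ν : ℕ) (t : ℝ) :
    HasDerivAt (tapCoeff (q + 1) ν)
      ((q + 1) * ν.choose (q + 1) * (1 - t) ^ q * t ^ (ν - (q + 1))) t := by
  induction q with
  | zero =>
    rw [zero_add, show tapCoeff 1 ν = fun t => t ^ ν from funext (tapCoeff_one_left ν)]
    exact (hasDerivAt_pow ν t).congr_deriv (by simp)
  | succ q ih =>
    have hsub : HasDerivAt (fun t : ℝ => 1 - t) (-1) t := by
      simpa using (hasDerivAt_id t).const_sub 1
    have new_term := ((hsub.pow (q + 1)).const_mul (ν.choose (q + 1) : ℝ)).mul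
      (hasDerivAt_pow (ν - (q + 1)) t)
    rw [show tapCoeff (q + 1 + 1) ν = _ from funext (tapCoeff_succ (q + 1) ν)]
    refine (ih.add new_term).congr_deriv ?_
    have choose_rec : (ν.choose (q + 1 + 1) : ℝ) * (q + 1 + 1) =
        ν.choose (q + 1) * ((ν - (q + 1) : ℕ) : ℝ) := by
      exact_mod_cast Nat.choose_succ_right_eq ν (q + 1)
    simp only [Pi.pow_apply, Nat.sub_sub]
    push_cast
    linear_combination (-(1 - t) ^ (q + 1) * t ^ (ν - (q + 1 + 1))) * choose_rec

theorem monotoneOn_tapCoeff_succ (q ν : ℕ) :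
    MonotoneOn (tapCoeff (q + 1) ν) (Set.Icc 0 1) := by
  refine monotoneOn_of_hasDerivWithinAt_nonneg (convex_Icc 0 1)
    (continuous_tapCoeff _ _).continuousOn
    (fun x _ => (hasDerivAt_tapCoeff_succ q ν x).hasDerivWithinAt) fun x hx => ?_
  rw [interior_Icc] at hx
  have h0 := hx.1.le
  have h1 := sub_nonneg.2 hx.2.le
  positivity

theorem tapCoeff_succ_sub_le (q ν : ℕ) {h : ℝ} (h0 : 0 ≤ h) (h1 : h ≤ 1 / 2) :
    tapCoeff (q + 1) ν (1 - h) - tapCoeff (q + 1) ν (1 - 2 * h) ≤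
      (4 * h) ^ (q + 1) * (ν.descFactorial (q + 1) * (1 - h) ^ ν) := by
  have hle : 1 - 2 * h ≤ 1 - h := by linarith
  have mean_value := (convex_Icc (1 - 2 * h) (1 - h)).image_sub_le_mul_sub_of_deriv_le
    (f := tapCoeff (q + 1) ν) (continuous_tapCoeff _ _).continuousOn
    (fun x _ => (hasDerivAt_tapCoeff_succ q ν x).differentiableAt.differentiableWithinAt)
    (C := (q + 1) * ν.choose (q + 1) * (2 * h) ^ q * (1 - h) ^ (ν - (q + 1)))
    (fun x hx => by
      rw [interior_Icc] at hx
      rw [(hasDerivAt_tapCoeff_succ q ν x).deriv]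
      have hx0 : 0 ≤ x := by linarith [hx.1]
      have hx1 : 0 ≤ 1 - x := by linarith [hx.2]
      gcongr
      · linarith [hx.1]
      · exact hx.2.le)
    _ (Set.left_mem_Icc.2 hle) _ (Set.right_mem_Icc.2 hle) hle
  have choose_le : (q + 1) * ν.choose (q + 1) ≤ (ν.descFactorial (q + 1) : ℝ) := by
    rw [Nat.descFactorial_eq_factorial_mul_choose]
    exact_mod_cast Nat.mul_le_mul_right _ (Nat.self_le_factorial (q + 1))
  have hh : 0 ≤ 1 - h := by linarith
  calc tapCoeff (q + 1) ν (1 - h) - tapCoeff (q + 1) ν (1 - 2 * h)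
      ≤ (q + 1) * ν.choose (q + 1) * (2 * h) ^ q * (1 - h) ^ (ν - (q + 1)) * h :=
        mean_value.trans_eq (by ring)
    _ ≤ ν.descFactorial (q + 1) * (2 * h) ^ q * (2 ^ (q + 1) * (1 - h) ^ ν) * (2 * h) := by
        gcongr
        · exact pow_sub_le_mul_pow hh (by linarith) (by linarith) ν (q + 1)
        · linarith
    _ = _ := by
        rw [show (4 : ℝ) * h = 2 * (2 * h) by ring, mul_pow 2 (2 * h)]
        ring

theorem ofReal_one_sub_tapCoeff_succ_le (q ν : ℕ) {δ : ℝ} (hδ : δ ∈ Set.Icc 0 1) :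
    ENNReal.ofReal (1 - tapCoeff (q + 1) ν (1 - δ)) ≤
      ∑' j : ℕ, .ofReal ((4 * (δ / 2 ^ (j + 1))) ^ (q + 1)) *
        .ofReal (ν.descFactorial (q + 1) * (1 - δ / 2 ^ (j + 1)) ^ ν) := by
  have hδ0 : 0 ≤ δ := hδ.1
  have half_le (j : ℕ) : δ / 2 ^ (j + 1) ≤ 1 / 2 := by
    rw [pow_succ, ← div_div]
    gcongr
    exact (div_le_self hδ0 (one_le_pow₀ one_le_two)).trans hδ.2
  have double (j : ℕ) : δ / 2 ^ j = 2 * (δ / 2 ^ (j + 1)) := by rw [pow_succ]; field_simp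
  have nonneg (j : ℕ) : 0 ≤ δ / 2 ^ (j + 1) := by positivity
  have increment_nonneg (j : ℕ) :
      0 ≤ tapCoeff (q + 1) ν (1 - δ / 2 ^ (j + 1)) - tapCoeff (q + 1) ν (1 - δ / 2 ^ j) := by
    rw [double j]
    refine sub_nonneg.2 (monotoneOn_tapCoeff_succ q ν ⟨?_, ?_⟩ ⟨?_, ?_⟩ ?_) <;>
      linarith [half_le j, nonneg j]
  have tends_one : Tendsto (fun j : ℕ => 1 - δ / 2 ^ j) atTop (𝓝 1) := by
    simpa [div_eq_mul_inv] using
      ((tendsto_pow_atTop_nhds_zero_of_lt_one (r := (2⁻¹ : ℝ)) (by norm_num)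
        (by norm_num)).const_mul δ).const_sub 1
  have telescope :
      HasSum (fun j : ℕ =>
          tapCoeff (q + 1) ν (1 - δ / 2 ^ (j + 1)) - tapCoeff (q + 1) ν (1 - δ / 2 ^ j))
        (1 - tapCoeff (q + 1) ν (1 - δ)) := by
    rw [hasSum_iff_tendsto_nat_of_nonneg increment_nonneg]
    simp_rw [Finset.sum_range_sub fun j : ℕ => tapCoeff (q + 1) ν (1 - δ / 2 ^ j)]
    rw [pow_zero, div_one]
    refine Tendsto.sub_const ?_ _
    exact ((continuous_tapCoeff (q + 1) ν).tendsto' 1 1 (tapCoeff_succ_one_right q ν)).comp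
      tends_one
  rw [← telescope.tsum_eq, ENNReal.ofReal_tsum_of_nonneg increment_nonneg telescope.summable]
  refine ENNReal.tsum_le_tsum fun j => ?_
  rw [← ENNReal.ofReal_mul (by positivity), double j]
  exact ENNReal.ofReal_le_ofReal (tapCoeff_succ_sub_le q ν (nonneg j) (half_le j))

end TapCoeff

section Equivalence

variable {d : ℕ} {p : ℝ} {Φ : ℝ → ℝ≥0∞} (m : (Fin d → ℤ) → ℕ) (b : TrigSeries d)

theorem spNorm_one_sub_tapCoeff_succ_le (hp : 1 ≤ p) (q : ℕ) {δ : ℝ} (hδ : δ ∈ Set.Icc 0 1) :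
    spNorm p (fun k => (1 - tapCoeff (q + 1) (m k) (1 - δ)) • b k) ≤
      .ofReal (4 ^ (q + 1) * δ ^ q) * ∑' j : ℕ, .ofReal (δ / 2 ^ j) *
        spNorm p (fun k => ((m k).descFactorial (q + 1) * (1 - δ / 2 ^ j) ^ m k) • b k) := by
  have hδ0 : 0 ≤ δ := hδ.1
  have le_self (j : ℕ) : δ / 2 ^ j ≤ δ := div_le_self hδ0 (one_le_pow₀ one_le_two)
  calc spNorm p (fun k => (1 - tapCoeff (q + 1) (m k) (1 - δ)) • b k)
      ≤ ∑' j : ℕ, .ofReal ((4 * (δ / 2 ^ (j + 1))) ^ (q + 1)) * spNorm p (fun k =>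
          ((m k).descFactorial (q + 1) * (1 - δ / 2 ^ (j + 1)) ^ m k) • b k) := by
        refine spNorm_le_tsum hp fun k => ?_
        have coeff_le := tapCoeff_le_one (q + 1) (m k) (sub_nonneg.2 hδ.2) (sub_le_self 1 hδ0)
        grw [enorm_smul, Real.enorm_eq_ofReal (sub_nonneg.2 coeff_le),
          ofReal_one_sub_tapCoeff_succ_le q (m k) hδ, ← ENNReal.tsum_mul_right]
        refine ENNReal.tsum_le_tsum fun j => ?_
        have base_nonneg := sub_nonneg.2 ((le_self (j + 1)).trans hδ.2)
        rw [enorm_smul, Real.enorm_eq_ofReal (by positivity), mul_assoc]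
    _ ≤ ∑' j : ℕ, .ofReal (4 ^ (q + 1) * δ ^ q) * (.ofReal (δ / 2 ^ (j + 1)) * spNorm p (fun k =>
          ((m k).descFactorial (q + 1) * (1 - δ / 2 ^ (j + 1)) ^ m k) • b k)) := by
        refine ENNReal.tsum_le_tsum fun j => ?_
        rw [← mul_assoc, ← ENNReal.ofReal_mul (by positivity)]
        gcongr
        rw [mul_pow, pow_succ (δ / 2 ^ (j + 1)), ← mul_assoc]
        gcongr
        exact le_self _
    _ ≤ _ := by
        rw [ENNReal.tsum_mul_left]
        refine mul_le_mul' le_rfl ?_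
        exact ENNReal.tsum_comp_le_tsum_of_injective (add_left_injective 1) fun j : ℕ =>
          .ofReal (δ / 2 ^ j) * spNorm p (fun k =>
            ((m k).descFactorial (q + 1) * (1 - δ / 2 ^ j) ^ m k) • b k)

theorem mul_pow_le_factorial_mul_one_sub_tapCoeff (r ν : ℕ) {δ : ℝ} (hδ : δ ∈ Set.Icc 0 1) :
    δ ^ r * (ν.descFactorial r * (1 - δ) ^ ν) ≤
      r.factorial * (1 - tapCoeff r ν (1 - δ)) := by
  have h0 : 0 ≤ 1 - δ := sub_nonneg.2 hδ.2
  have h1 : 1 - δ ≤ 1 := sub_le_self 1 hδ.1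
  have hδ0 := hδ.1
  grw [← choose_mul_le_one_sub_tapCoeff r ν h0 h1, sub_sub_cancel,
    Nat.descFactorial_eq_factorial_mul_choose,
    pow_le_pow_of_le_one h0 h1 (Nat.sub_le ν r)]
  exact (by push_cast; ring : _ = _).le

theorem eBigO_spNorm_one_sub_tapCoeff_iff (hp : 1 ≤ p) (hΦ : DyadicBari Φ) {r : ℕ} (hr : 1 ≤ r) :
    EBigO (𝓝[>] 0) (fun δ => spNorm p fun k => (1 - tapCoeff r (m k) (1 - δ)) • b k)
        (fun δ => .ofReal (δ ^ (r - 1)) * Φ δ) ↔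
      EBigO (𝓝[>] 0) (fun δ => .ofReal δ *
        spNorm p fun k => ((m k).descFactorial r * (1 - δ) ^ m k : ℝ) • b k) Φ := by
  obtain ⟨q, rfl⟩ := Nat.exists_eq_add_of_le' hr
  have hp0 : 0 < p := zero_lt_one.trans_le hp
  have near : ∀ᶠ δ : ℝ in 𝓝[>] 0, δ ∈ Set.Ioc 0 1 := Ioc_mem_nhdsGT one_pos
  constructor
  · refine fun h => (eBigO_mul_left_iff (w := fun δ => δ ^ q) ?_).1
      (EBigO.trans (.of_le (C := .ofReal (q + 1).factorial) ENNReal.ofReal_ne_top ?_) h)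
    · filter_upwards [near] with δ hδ using pow_pos hδ.1 q
    filter_upwards [near] with δ hδ
    have hδ0 := hδ.1
    rw [← mul_assoc, ← ENNReal.ofReal_mul (by positivity), ← pow_succ]
    refine mul_spNorm_le_mul hp0 (by positivity) fun k => ?_
    have coeff_nonneg : 0 ≤ 1 - tapCoeff (q + 1) (m k) (1 - δ) :=
      sub_nonneg.2 (tapCoeff_le_one _ _ (sub_nonneg.2 hδ.2) (sub_le_self 1 hδ0.le))
    have base_nonneg : 0 ≤ 1 - δ := sub_nonneg.2 hδ.2
    rw [norm_smul, norm_smul, Real.norm_of_nonneg coeff_nonneg, Real.norm_of_nonneg (by positivity),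
      ← mul_assoc, ← mul_assoc ((q + 1).factorial : ℝ)]
    exact mul_le_mul_of_nonneg_right (mul_pow_le_factorial_mul_one_sub_tapCoeff _ _
      (Set.Ioc_subset_Icc_self hδ)) (norm_nonneg _)
  · intro h
    refine EBigO.trans ?_ ((EBigO.mul_left (h.tsum_dyadic hΦ) fun δ => .ofReal (δ ^ q)))
    refine .of_le (C := .ofReal (4 ^ (q + 1))) ENNReal.ofReal_ne_top ?_
    filter_upwards [near] with δ hδ
    rw [← mul_assoc, ← ENNReal.ofReal_mul (by positivity)]
    exact spNorm_one_sub_tapCoeff_succ_le m b hp q (Set.Ioc_subset_Icc_self hδ)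

end Equivalence

section Expo

variable {d : ℕ}

theorem expo_neg_diag (k : Fin d → ℤ) (h : ℝ) :
    expo k (-diag d h) = Complex.exp (Complex.I * ((-(h * ∑ j, (k j : ℝ)) : ℝ) : ℂ)) := by
  have pi_ne_zero : (Real.pi : ℂ) ≠ 0 := Complex.ofReal_ne_zero.2 Real.pi_ne_zero
  have fourier_neg_diag (j : Fin d) :
      fourier (k j) ((-diag d h) j) = Complex.exp (Complex.I * ((-(h * k j) : ℝ) : ℂ)) := by
    rw [Pi.neg_apply, diag, ← AddCircle.coe_neg, fourier_coe_apply]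
    push_cast
    congr 1
    field_simp
  simp only [expo, fourier_neg_diag, ← Complex.exp_sum, ← Finset.mul_sum, ← Complex.ofReal_sum,
    Finset.sum_neg_distrib]

theorem norm_sub_mul_expo_neg_diag (a : ℂ) (k : Fin d → ℤ) (h : ℝ) :
    ‖a - a * expo k (-diag d h)‖ = 2 * |Real.sin (h * (∑ j, (k j : ℝ)) / 2)| * ‖a‖ := by
  rw [← mul_one_sub, norm_mul, norm_sub_rev, expo_neg_diag,
    Complex.norm_exp_I_mul_ofReal_sub_one, norm_mul, Real.norm_eq_abs, Real.norm_eq_abs, abs_two,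
    neg_div, Real.sin_neg, abs_neg, mul_comm]

theorem abs_sum_le_l1 (k : Fin d → ℤ) : |∑ j, (k j : ℝ)| ≤ l1 k := by
  refine (Finset.abs_sum_le_sum_abs _ _).trans_eq ?_
  simp [l1, Nat.cast_natAbs]

theorem abs_sum_eq_l1 {k : Fin d → ℤ} (hk : (∀ j, 0 ≤ k j) ∨ ∀ j, k j < 0) :
    |∑ j, (k j : ℝ)| = l1 k := by
  simp only [l1, Nat.cast_sum, Nat.cast_natAbs, Int.cast_abs]
  rcases hk with nonneg | neg
  · have cast_nonneg (j : Fin d) : (0 : ℝ) ≤ k j := Int.cast_nonneg (nonneg j)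
    simp only [abs_of_nonneg (cast_nonneg _), abs_of_nonneg (Finset.sum_nonneg fun j _ =>
      cast_nonneg j)]
  · have cast_nonpos (j : Fin d) : (k j : ℝ) ≤ 0 := Int.cast_nonpos.2 (neg j).le
    simp only [abs_of_nonpos (cast_nonpos _), abs_of_nonpos (Finset.sum_nonpos fun j _ =>
      cast_nonpos j), Finset.sum_neg_distrib]

theorem norm_sub_mul_expo_neg_diag_le (a : ℂ) (k : Fin d → ℤ) {h δ : ℝ} (hh : |h| ≤ δ) :
    ‖a - a * expo k (-diag d h)‖ ≤ min 2 (l1 k * δ) * ‖a‖ := by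
  rw [norm_sub_mul_expo_neg_diag]
  refine mul_le_mul_of_nonneg_right (le_min ?_ ?_) (norm_nonneg _)
  · linarith [Real.abs_sin_le_one (h * (∑ j, (k j : ℝ)) / 2)]
  · calc 2 * |Real.sin (h * (∑ j, (k j : ℝ)) / 2)| ≤ 2 * |h * (∑ j, (k j : ℝ)) / 2| := by
          exact mul_le_mul_of_nonneg_left Real.abs_sin_le_abs zero_le_two
      _ = |∑ j, (k j : ℝ)| * |h| := by rw [abs_div, abs_mul, abs_two]; ring
      _ ≤ l1 k * δ := mul_le_mul (abs_sum_le_l1 k) hh (abs_nonneg _) (Nat.cast_nonneg _)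

theorem tendsto_l1_cofinite_atTop : Tendsto (l1 (d := d)) cofinite atTop := by
  refine tendsto_atTop.2 fun n => ?_
  refine (Set.finite_Icc (fun _ : Fin d => -(n : ℤ)) fun _ => n).subset fun k hk => ?_
  have abs_le (j : Fin d) : |k j| ≤ n := by
    rw [Int.abs_eq_natAbs, Nat.cast_le]
    exact (Finset.single_le_sum (f := fun j => (k j).natAbs) (fun _ _ => Nat.zero_le _)
      (Finset.mem_univ j)).trans (Nat.le_of_not_le hk)
  exact ⟨fun j => neg_le_of_abs_le (abs_le j), fun j => le_of_abs_le (abs_le j)⟩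

end Expo

section Inequalities

variable {δ : ℝ}

theorem one_sub_pow_mul_one_add_le_one (hδ : δ ∈ Set.Icc 0 1) (ν : ℕ) :
    (1 - δ) ^ ν * (1 + ν * δ) ≤ 1 := by
  obtain ⟨h0, h1⟩ := hδ
  calc (1 - δ) ^ ν * (1 + ν * δ) ≤ (1 - δ) ^ ν * (1 + δ) ^ ν :=
        mul_le_mul_of_nonneg_left (one_add_mul_le_pow (by linarith) ν)
          (pow_nonneg (by linarith) ν)
    _ = (1 - δ ^ 2) ^ ν := by rw [← mul_pow]; ring
    _ ≤ 1 := pow_le_one₀ (by nlinarith) (by nlinarith)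

theorem min_two_le_three_mul_one_sub_pow (hδ : δ ∈ Set.Icc 0 1) (ν : ℕ) :
    min 2 (ν * δ) ≤ 3 * (1 - (1 - δ) ^ ν) := by
  have bound := one_sub_pow_mul_one_add_le_one hδ ν
  have base_nonneg : 0 ≤ (1 - δ) ^ ν := pow_nonneg (sub_nonneg.2 hδ.2) ν
  have base_le_one : (1 - δ) ^ ν ≤ 1 := pow_le_one₀ (sub_nonneg.2 hδ.2) (sub_le_self 1 hδ.1)
  rcases le_total (ν * δ) 2 with h | h
  · exact (min_le_right _ _).trans (by nlinarith)
  · exact (min_le_left _ _).trans (by nlinarith)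

theorem min_two_le_three_mul_one_sub_pow_sub_add (hδ : δ ∈ Set.Icc 0 1) (ν q : ℕ) :
    min 2 (ν * δ) ≤ 3 * (1 - (1 - δ) ^ (ν - q)) + q * δ := by
  have ν_le : (ν : ℝ) ≤ (ν - q : ℕ) + q := by exact_mod_cast le_tsub_add
  have hδ0 := hδ.1
  calc min 2 (ν * δ) ≤ min (2 + q * δ) ((ν - q : ℕ) * δ + q * δ) :=
        min_le_min (by simp only [le_add_iff_nonneg_right]; positivity) (by nlinarith)
    _ = min 2 ((ν - q : ℕ) * δ) + q * δ := min_add_add_right ..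
    _ ≤ _ := by gcongr; exact min_two_le_three_mul_one_sub_pow hδ _

theorem mul_one_sub_pow_le_min (hδ : δ ∈ Set.Icc 0 1) (ν : ℕ) :
    ν * (1 - δ) ^ ν * δ ≤ min 1 (ν * δ) := by
  have bound := one_sub_pow_mul_one_add_le_one hδ ν
  have base_nonneg : 0 ≤ (1 - δ) ^ ν := pow_nonneg (sub_nonneg.2 hδ.2) ν
  have base_le_one : (1 - δ) ^ ν ≤ 1 := pow_le_one₀ (sub_nonneg.2 hδ.2) (sub_le_self 1 hδ.1)
  have := mul_nonneg (Nat.cast_nonneg (α := ℝ) ν) hδ.1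
  exact le_min (by nlinarith) (by nlinarith)

theorem exists_min_one_abs_le_mul_abs_sin (y : ℝ) :
    ∃ j : ℕ, min 1 |y| ≤ 4 * |Real.sin (y / 2 ^ j / 2)| := by
  have abs_le_mul_abs_sin {z : ℝ} (hz : |z| ≤ 2) : |z| ≤ 4 * |Real.sin (z / 2)| := by
    have half_eq : |z / 2| = |z| / 2 := by rw [abs_div, abs_two]
    have jordan := Real.mul_abs_le_abs_sin (x := z / 2) (by linarith [Real.pi_gt_three])
    have : 1 / 2 ≤ 2 / Real.pi := by
      rw [div_le_div_iff₀ two_pos Real.pi_pos]; linarith [Real.pi_le_four]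
    nlinarith [abs_nonneg z]
  rcases le_total |y| 2 with h | h
  · exact ⟨0, (min_le_right _ _).trans (by simpa using abs_le_mul_abs_sin h)⟩
  · obtain ⟨j, pow_le, lt_pow⟩ := exists_nat_pow_near (one_le_two.trans h) one_lt_two
    have abs_eq : |y / 2 ^ j| = |y| / 2 ^ j := by rw [abs_div, abs_pow, abs_two]
    refine ⟨j, (min_le_left _ _).trans (le_trans ?_ (abs_le_mul_abs_sin ?_))⟩
    · rwa [abs_eq, one_le_div (by positivity)]
    · rw [abs_eq, div_le_iff₀ (by positivity), ← pow_succ']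
      exact lt_pow.le

end Inequalities

section Rates

variable {d q : ℕ} {p : ℝ} {Φ : ℝ → ℝ≥0∞} {c : TrigSeries d}

/-- The derivative `c^{[r]}` of a trigonometric series, with the coefficients
`ν! / (ν - r)! c_k` for `|k|₁ = ν`; the falling factorial vanishes for `ν < r`. -/
def derivSeries (r : ℕ) (c : TrigSeries d) : TrigSeries d :=
  fun k => ((l1 k).descFactorial r : ℝ) • c k

theorem radialDeriv_eq_derivSeries (r : ℕ) (f : Torus d → ℂ) :
    radialDeriv r f = derivSeries r (fourierSeries f) := by
  funext k
  rw [radialDeriv, psiDeriv, radialPsi, derivSeries]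
  rcases lt_or_ge (l1 k) r with h | h
  · simp [h, Nat.descFactorial_of_lt h]
  · have sub_ne : ((l1 k - r).factorial : ℂ) ≠ 0 := Nat.cast_ne_zero.2 (Nat.factorial_ne_zero _)
    have self_ne : ((l1 k).factorial : ℂ) ≠ 0 := Nat.cast_ne_zero.2 (Nat.factorial_ne_zero _)
    have split : ((l1 k - r).factorial : ℂ) * (l1 k).descFactorial r = (l1 k).factorial :=
      mod_cast Nat.factorial_mul_descFactorial h
    rw [if_neg h.not_gt, if_neg (div_ne_zero sub_ne self_ne), ← split, Complex.real_smul,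
      Complex.ofReal_natCast]
    field_simp

theorem derivSeries_zero (c : TrigSeries d) : derivSeries 0 c = c := by
  funext k
  simp [derivSeries]

theorem derivSeries_succ (q : ℕ) (c : TrigSeries d) (k : Fin d → ℤ) :
    derivSeries (q + 1) c k = ((l1 k - q : ℕ) : ℝ) • derivSeries q c k := by
  rw [derivSeries, derivSeries, smul_smul, Nat.descFactorial_succ, Nat.cast_mul]

/-- The norm `‖P(c)(1 - δ, ·)‖` of the Poisson means of a trigonometric series. -/
def poissonNorm (p : ℝ) (c : TrigSeries d) (δ : ℝ) : ℝ≥0∞ :=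
  spNorm p fun k => (1 - δ) ^ l1 k • c k

/-- The norm of the error `c - A_{1-δ,r}(c)` of the Taylor–Abel–Poisson means. -/
def tapError (p : ℝ) (r : ℕ) (c : TrigSeries d) (δ : ℝ) : ℝ≥0∞ :=
  spNorm p fun k => (1 - tapCoeff r (l1 k) (1 - δ)) • c k

theorem eBigO_tapError_iff (hp : 1 ≤ p) (hΦ : DyadicBari Φ) :
    EBigO (𝓝[>] 0) (tapError p (q + 1) c) (fun δ => .ofReal (δ ^ q) * Φ δ) ↔
      EBigO (𝓝[>] 0) (fun δ => .ofReal δ * poissonNorm p (derivSeries (q + 1) c) δ) Φ := by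
  have core := eBigO_spNorm_one_sub_tapCoeff_iff l1 c hp hΦ (Nat.le_add_left 1 q)
  simp only [add_tsub_cancel_right, mul_smul, smul_comm (Nat.cast _ : ℝ)] at core
  exact core

theorem EBigO.spNorm_one_sub_pow_smul_derivSeries (hp : 1 ≤ p) (hΦ : DyadicBari Φ)
    (h : EBigO (𝓝[>] 0) (fun δ => .ofReal δ * poissonNorm p (derivSeries (q + 1) c) δ) Φ) :
    EBigO (𝓝[>] 0)
      (fun δ => spNorm p fun k => (1 - (1 - δ) ^ (l1 k - q)) • derivSeries q c k) Φ := by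
  have core := eBigO_spNorm_one_sub_tapCoeff_iff (fun k => l1 k - q) (derivSeries q c) hp hΦ le_rfl
  simp only [tapCoeff_one_left, Nat.descFactorial_one, tsub_self, pow_zero, ENNReal.ofReal_one,
    one_mul] at core
  refine core.2 (EBigO.trans (.of_le (C := .ofReal (2 ^ q)) ENNReal.ofReal_ne_top ?_) h)
  filter_upwards [Ioc_mem_nhdsGT one_half_pos] with δ hδ
  have base_nonneg : 0 ≤ 1 - δ := by linarith [hδ.2]
  rw [mul_left_comm]
  refine mul_le_mul' le_rfl (spNorm_le_mul (zero_lt_one.trans_le hp) fun k => ?_)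
  rw [derivSeries_succ, mul_comm, mul_smul, norm_smul, norm_smul ((1 - δ) ^ l1 k), ← mul_assoc,
    Real.norm_of_nonneg (by positivity), Real.norm_of_nonneg (by positivity)]
  gcongr
  exact pow_sub_le_mul_pow base_nonneg (by linarith [hδ.1]) (by linarith [hδ.2]) _ _

theorem spNorm_derivSeries_lt_top (hp : 1 ≤ p) (hfin : ∀ᶠ δ in 𝓝[>] 0, Φ δ < ∞)
    (h : EBigO (𝓝[>] 0)
      (fun δ => spNorm p fun k => (1 - (1 - δ) ^ (l1 k - q)) • derivSeries q c k) Φ) :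
    spNorm p (derivSeries q c) < ∞ := by
  have hp0 : 0 < p := zero_lt_one.trans_le hp
  obtain ⟨C, hC⟩ := h
  obtain ⟨δ, bound, finite, hδ⟩ := (hC.and (hfin.and (Ioc_mem_nhdsGT one_pos))).exists
  beta_reduce at bound
  have low_finite : (Function.support fun k =>
      if q < l1 k then 0 else derivSeries q c k).Finite := by
    refine (tendsto_l1_cofinite_atTop.eventually_gt_atTop q).subset fun k hk => ?_
    exact fun hlt => hk (if_pos hlt)
  refine (spNorm_le_add hp (b := fun k => δ⁻¹ • (1 - (1 - δ) ^ (l1 k - q)) • derivSeries q c k)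
    fun k => ?_).trans_lt (ENNReal.add_lt_top.2
      ⟨?_, spNorm_lt_top_of_finite_support hp0 low_finite⟩)
  · split_ifs with hk
    · have base_le : (1 - δ) ^ (l1 k - q) ≤ 1 - δ :=
        pow_le_of_le_one (sub_nonneg.2 hδ.2) (sub_le_self 1 hδ.1.le) (Nat.sub_ne_zero_of_lt hk)
      rw [enorm_zero, add_zero, enorm_le_iff_norm_le, smul_smul, norm_smul]
      refine le_mul_of_one_le_left (norm_nonneg _) ((one_le_inv_mul₀ hδ.1).2 ?_ |>.trans
        (Real.le_norm_self _))
      linarith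
    · exact le_add_self
  · grw [spNorm_le_mul hp0 (C := ‖δ⁻¹‖) fun k => (norm_smul _ _).le, bound]
    exact ENNReal.mul_lt_top ENNReal.ofReal_lt_top (ENNReal.mul_lt_top ENNReal.coe_lt_top finite)

theorem modulusSeries_derivSeries_le (hp : 1 ≤ p) {δ : ℝ} (hδ : δ ∈ Set.Icc 0 1) :
    modulusSeries p (derivSeries q c) δ ≤
      3 * spNorm p (fun k => (1 - (1 - δ) ^ (l1 k - q)) • derivSeries q c k) +
        q * spNorm p (derivSeries q c) * .ofReal δ := by
  have hp0 : 0 < p := zero_lt_one.trans_le hp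
  have hδ0 := hδ.1
  refine iSup₂_le fun h hh => ?_
  refine (spNorm_le_add hp (b := fun k => (3 : ℝ) • (1 - (1 - δ) ^ (l1 k - q)) • derivSeries q c k)
    (c := (q * δ) • derivSeries q c) fun k => ?_).trans (add_le_add ?_ ?_)
  · have power_nonneg : 0 ≤ 1 - (1 - δ) ^ (l1 k - q) :=
      sub_nonneg.2 (pow_le_one₀ (sub_nonneg.2 hδ.2) (sub_le_self 1 hδ0))
    rw [← ofReal_norm, ← ofReal_norm, ← ofReal_norm,
      ← ENNReal.ofReal_add (norm_nonneg _) (norm_nonneg _), Pi.smul_apply, norm_smul, norm_smul,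
      norm_smul, Real.norm_of_nonneg power_nonneg, Real.norm_of_nonneg zero_le_three,
      Real.norm_of_nonneg (by positivity), ← mul_assoc, ← add_mul]
    grw [norm_sub_mul_expo_neg_diag_le _ _ hh, min_two_le_three_mul_one_sub_pow_sub_add hδ _ q]
  · rw [← ENNReal.ofReal_ofNat 3]
    exact spNorm_le_mul hp0 fun k => by simp
  · rw [mul_right_comm, ← ENNReal.ofReal_natCast q, ← ENNReal.ofReal_mul (Nat.cast_nonneg q)]
    exact spNorm_le_mul hp0 fun k => by
      rw [Pi.smul_apply, norm_smul, Real.norm_of_nonneg (by positivity)]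

theorem eBigO_ofReal_of_derivSeries_ne_zero (hp : 0 < p) {k : Fin d → ℤ}
    (hk : derivSeries (q + 1) c k ≠ 0)
    (h : EBigO (𝓝[>] 0) (fun δ => .ofReal δ * poissonNorm p (derivSeries (q + 1) c) δ) Φ) :
    EBigO (𝓝[>] 0) ENNReal.ofReal Φ := by
  set e : ℝ≥0∞ := ‖(1 / 2 : ℝ) ^ l1 k • derivSeries (q + 1) c k‖ₑ
  have e_ne_zero : e ≠ 0 := by simp [e, hk]
  refine EBigO.trans (.of_le (ENNReal.inv_ne_top.2 e_ne_zero) ?_) h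
  filter_upwards [Ioc_mem_nhdsGT one_half_pos] with δ hδ
  have e_le : e ≤ poissonNorm p (derivSeries (q + 1) c) δ := by
    refine le_trans ?_ (enorm_le_spNorm hp _ k)
    have base_ge : 1 / 2 ≤ 1 - δ := by linarith [hδ.2]
    rw [enorm_le_iff_norm_le, norm_smul, norm_smul, norm_pow, norm_pow,
      Real.norm_of_nonneg one_half_pos.le, Real.norm_of_nonneg (one_half_pos.le.trans base_ge)]
    gcongr
  calc ENNReal.ofReal δ = e⁻¹ * (.ofReal δ * e) := by
        rw [mul_left_comm, ENNReal.inv_mul_cancel e_ne_zero enorm_ne_top, mul_one]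
    _ ≤ e⁻¹ * (.ofReal δ * poissonNorm p (derivSeries (q + 1) c) δ) := by gcongr

theorem EBigO.modulusSeries_derivSeries (hp : 1 ≤ p) (hΦ : DyadicBari Φ)
    (hfin : ∀ᶠ δ in 𝓝[>] 0, Φ δ < ∞)
    (hO : q ≠ 0 → derivSeries (q + 1) c = 0 → EBigO (𝓝[>] 0) ENNReal.ofReal Φ)
    (h : EBigO (𝓝[>] 0) (fun δ => .ofReal δ * poissonNorm p (derivSeries (q + 1) c) δ) Φ) :
    spNorm p (derivSeries q c) < ∞ ∧ EBigO (𝓝[>] 0) (modulusSeries p (derivSeries q c)) Φ := by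
  have increment := h.spNorm_one_sub_pow_smul_derivSeries hp hΦ
  have finite := spNorm_derivSeries_lt_top hp hfin increment
  have linear_term : EBigO (𝓝[>] 0)
      (fun δ => q * spNorm p (derivSeries q c) * .ofReal δ) Φ := by
    rcases eq_or_ne q 0 with rfl | hq
    · exact ⟨0, by simp⟩
    refine EBigO.const_mul (ENNReal.mul_ne_top (ENNReal.natCast_ne_top q) finite.ne) ?_
    by_cases deriv_eq_zero : derivSeries (q + 1) c = 0
    · exact hO hq deriv_eq_zero
    · obtain ⟨k, hk⟩ := Function.ne_iff.1 deriv_eq_zero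
      exact eBigO_ofReal_of_derivSeries_ne_zero (zero_lt_one.trans_le hp) hk h
  refine ⟨finite, EBigO.trans (.of_le ENNReal.one_ne_top ?_)
    ((increment.const_mul (ENNReal.ofNat_ne_top (n := 3))).add linear_term)⟩
  filter_upwards [Ioc_mem_nhdsGT one_pos] with δ hδ
  rw [one_mul]
  exact modulusSeries_derivSeries_le hp (Set.Ioc_subset_Icc_self hδ)

theorem exists_mul_norm_derivSeries_succ_le {K δ : ℝ} (hδ : δ ∈ Set.Ioc 0 1) {k : Fin d → ℤ}
    (hk : c k ≠ 0 → l1 k ≤ K * |∑ j, (k j : ℝ)|) :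
    ∃ j : ℕ, δ * ‖(1 - δ) ^ l1 k • derivSeries (q + 1) c k‖ ≤ 2 * max 1 K *
      ‖derivSeries q c k - derivSeries q c k * expo k (-diag d (δ / 2 ^ j))‖ := by
  rcases eq_or_ne (c k) 0 with hc | hc
  · exact ⟨0, by simp [derivSeries, hc]⟩
  obtain ⟨j, hj⟩ := exists_min_one_abs_le_mul_abs_sin (δ * ∑ j, (k j : ℝ))
  refine ⟨j, ?_⟩
  have hδ0 := hδ.1
  have base_nonneg : 0 ≤ 1 - δ := sub_nonneg.2 hδ.2
  have K_pos : 0 < max 1 K := lt_max_of_lt_left one_pos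
  have weight_le : (l1 k - q : ℕ) * (1 - δ) ^ l1 k * δ ≤
      max 1 K * (4 * |Real.sin (δ * (∑ j, (k j : ℝ)) / 2 ^ j / 2)|) := by
    calc (l1 k - q : ℕ) * (1 - δ) ^ l1 k * δ ≤ l1 k * (1 - δ) ^ l1 k * δ := by
          gcongr; exact Nat.sub_le _ _
      _ ≤ min 1 (l1 k * δ) := mul_one_sub_pow_le_min (Set.Ioc_subset_Icc_self hδ) _
      _ ≤ min (max 1 K * 1) (max 1 K * |δ * ∑ j, (k j : ℝ)|) := by
          refine min_le_min (by simp) ?_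
          rw [abs_mul, abs_of_pos hδ0]
          grw [hk hc, le_max_right 1 K]
          exact (by ring : _ = _).le
      _ = max 1 K * min 1 |δ * ∑ j, (k j : ℝ)| := (mul_min_of_nonneg _ _ K_pos.le).symm
      _ ≤ _ := by gcongr
  rw [derivSeries_succ, smul_smul, norm_smul, Real.norm_of_nonneg (by positivity),
    norm_sub_mul_expo_neg_diag, div_mul_eq_mul_div]
  calc δ * ((1 - δ) ^ l1 k * (l1 k - q : ℕ) * ‖derivSeries q c k‖)
      = (l1 k - q : ℕ) * (1 - δ) ^ l1 k * δ * ‖derivSeries q c k‖ := by ring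
    _ ≤ _ := mul_le_mul_of_nonneg_right weight_le (norm_nonneg _)
    _ = _ := by ring

theorem EBigO.poissonNorm_derivSeries_succ (hp : 1 ≤ p) (hΦ : DyadicBari Φ) {K : ℝ}
    (hK : ∀ k, c k ≠ 0 → l1 k ≤ K * |∑ j, (k j : ℝ)|)
    (h : EBigO (𝓝[>] 0) (modulusSeries p (derivSeries q c)) Φ) :
    EBigO (𝓝[>] 0) (fun δ => .ofReal δ * poissonNorm p (derivSeries (q + 1) c) δ) Φ := by
  refine EBigO.trans (.of_le (C := .ofReal (2 * max 1 K)) ENNReal.ofReal_ne_top ?_)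
    (h.tsum_dyadic hΦ)
  filter_upwards [Ioc_mem_nhdsGT one_pos] with δ hδ
  have hδ0 := hδ.1
  have means_le : poissonNorm p (derivSeries (q + 1) c) δ ≤
      ∑' j : ℕ, .ofReal (2 * max 1 K / δ) * modulusSeries p (derivSeries q c) (δ / 2 ^ j) := by
    refine (spNorm_le_tsum hp (t := fun _ => 2 * max 1 K / δ) (b := fun j k =>
      derivSeries q c k - derivSeries q c k * expo k (-diag d (δ / 2 ^ j))) fun k => ?_).trans
        (ENNReal.tsum_le_tsum fun j => mul_le_mul' le_rfl ?_)
    · obtain ⟨j, hj⟩ := exists_mul_norm_derivSeries_succ_le (q := q) hδ (hK k)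
      refine le_trans ?_ (ENNReal.le_tsum j)
      rw [← ofReal_norm, ← ofReal_norm, ← ENNReal.ofReal_mul (by positivity), div_mul_eq_mul_div]
      exact ENNReal.ofReal_le_ofReal ((le_div_iff₀' hδ0).2 hj)
    · exact le_iSup₂_of_le (f := fun h (_ : |h| ≤ δ / 2 ^ j) =>
        spNorm p fun k => derivSeries q c k - derivSeries q c k * expo k (-diag d h))
        (δ / 2 ^ j) (abs_of_pos (by positivity)).le le_rfl
  grw [means_le, ENNReal.tsum_mul_left, ← mul_assoc, ← ENNReal.ofReal_mul hδ0.le,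
    mul_div_cancel₀ _ hδ0.ne']

end Rates

section FourierSeries

variable {d : ℕ}

theorem continuous_expo (k : Fin d → ℤ) : Continuous (expo k) :=
  continuous_finsetProd _ fun j _ => (fourier (k j)).continuous.comp (continuous_apply j)

theorem norm_expo (k : Fin d → ℤ) (x : Torus d) : ‖expo k x‖ = 1 := by
  simp only [expo, norm_prod, fourier_apply, Circle.norm_coe, Finset.prod_const_one]

theorem expo_add (k l : Fin d → ℤ) (x : Torus d) : expo (k + l) x = expo k x * expo l x := by
  simp [expo, ← Finset.prod_mul_distrib]

theorem expo_add_right (k : Fin d → ℤ) (x y : Torus d) :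
    expo k (x + y) = expo k x * expo k y := by
  simp [expo, ← Finset.prod_mul_distrib, fourier_apply, smul_add, AddCircle.toCircle_add]

theorem conj_expo (k : Fin d → ℤ) (x : Torus d) :
    starRingEnd ℂ (expo k x) = expo (-k) x := by
  simp only [expo, Pi.neg_apply, map_prod, fourier_neg]

theorem integrable_of_continuous {f : Torus d → ℂ} (hf : Continuous f) : Integrable f :=
  hf.integrable_of_hasCompactSupport (HasCompactSupport.of_compactSpace _)

theorem integrable_mul_expo {f : Torus d → ℂ} (hf : Integrable f) (k : Fin d → ℤ) :
    Integrable fun x => f x * expo k x :=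
  hf.mul_bdd (continuous_expo k).aestronglyMeasurable (.of_forall fun x => (norm_expo k x).le)

theorem two_pi_pow_ne_zero : ((2 * Real.pi : ℝ) : ℂ) ^ d ≠ 0 :=
  pow_ne_zero _ (Complex.ofReal_ne_zero.2 Real.two_pi_pos.ne')

theorem inv_two_pi_mul_integral_fourier (n : ℤ) :
    ((2 * Real.pi : ℝ) : ℂ)⁻¹ * ∫ x : AddCircle (2 * Real.pi), fourier n x =
      if n = 0 then 1 else 0 := by
  have coeff := congrFun (fourierCoeff_fourier (T := 2 * Real.pi) n) 0
  simpa [fourierCoeff, AddCircle.integral_haarAddCircle, Pi.single_apply, eq_comm] using coeff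

theorem fourierSeries_expo (k : Fin d → ℤ) : fourierSeries (expo k) = Pi.single k 1 := by
  funext l
  simp only [fourierSeries, ← expo_add]
  simp only [expo]
  rw [integral_fintype_prod_volume_eq_prod fun j (x : AddCircle (2 * Real.pi)) =>
    (fourier ((k + -l) j) x : ℂ), ← Fin.prod_const, ← Finset.prod_mul_distrib]
  simp only [inv_two_pi_mul_integral_fourier, Finset.prod_ite_zero, Pi.single_apply, funext_iff,
    Finset.mem_univ, true_imp_iff, Pi.add_apply, Pi.neg_apply, add_neg_eq_zero,
    Finset.prod_const_one, eq_comm]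

theorem fourierSeries_sub {f g : Torus d → ℂ} (hf : Integrable f) (hg : Integrable g) :
    fourierSeries (fun x => f x - g x) = fun k => fourierSeries f k - fourierSeries g k := by
  funext k
  simp only [fourierSeries, sub_mul]
  rw [integral_sub (integrable_mul_expo hf _) (integrable_mul_expo hg _), mul_sub]

theorem fourierSeries_congr_ae {f g : Torus d → ℂ} (h : f =ᵐ[volume] g) :
    fourierSeries f = fourierSeries g := by
  funext k
  rw [fourierSeries, fourierSeries, integral_congr_ae (h.mono fun x hx => by rw [hx])]

theorem fourierSeries_comp_add_left (g : Torus d → ℂ) (a : Torus d) (k : Fin d → ℤ) :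
    fourierSeries (fun x => g (a + x)) k = fourierSeries g k * expo k a := by
  have shift (x : Torus d) : expo (-k) x = expo (-k) (a + x) * expo k a := by
    rw [expo_add_right, mul_right_comm, ← expo_add, neg_add_cancel]
    simp [expo]
  rw [fourierSeries, integral_congr_ae (.of_forall fun x => congrArg (g (a + x) * ·) (shift x))]
  simp only [← mul_assoc]
  rw [integral_mul_const, integral_add_left_eq_self (fun x => g x * expo (-k) x), ← mul_assoc,
    fourierSeries]

theorem fourierSeries_sub_translate {g : Torus d → ℂ} (hg : Integrable g) (a : Torus d) :
    fourierSeries (fun x => g x - g (x - a)) =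
      fun k => fourierSeries g k - fourierSeries g k * expo k (-a) := by
  rw [fourierSeries_sub hg (hg.comp_sub_right a)]
  funext k
  rw [← fourierSeries_comp_add_left]
  simp only [neg_add_eq_sub]

theorem inSpH_iff {p : ℝ} {ω : ℝ → ℝ} {g : Torus d → ℂ} (hg : Integrable g) :
    InSpH p ω g ↔ SeriesInSpH p ω (fourierSeries g) := by
  simp only [InSpH, SeriesInSpH, modulus, modulusSeries, fourierSeries_sub_translate hg]

theorem fourierSeries_isBigO_one (f : Torus d → ℂ) :
    fourierSeries f =O[cofinite] fun _ => (1 : ℝ) := by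
  refine .of_bound (‖((2 * Real.pi : ℝ) : ℂ)⁻¹ ^ d‖ * ∫ x, ‖f x‖) (.of_forall fun k => ?_)
  rw [fourierSeries, norm_mul, norm_one, mul_one]
  gcongr
  simpa only [norm_mul, norm_expo, mul_one] using
    norm_integral_le_integral_norm fun x => f x * expo (-k) x

end FourierSeries

section AbsolutelyConvergent

variable {d : ℕ} {b : TrigSeries d}

theorem hasSum_tsum_mul_expo (hb : Summable fun k => ‖b k‖) (x : Torus d) :
    HasSum (fun k => b k * expo k x) (∑' k, b k * expo k x) :=
  Summable.hasSum <| .of_norm <| by simpa only [norm_mul, norm_expo, mul_one] using hb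

theorem integrable_tsum_mul_expo (hb : Summable fun k => ‖b k‖) :
    Integrable fun x : Torus d => ∑' k, b k * expo k x :=
  integrable_of_continuous <| continuous_tsum (fun k => continuous_const.mul (continuous_expo k)) hb
    fun k x => by rw [norm_mul, norm_expo, mul_one]

theorem hasSum_mul_fourierSeries_neg {f : Torus d → ℂ} (hf : Integrable f)
    (hb : Summable fun k => ‖b k‖) :
    HasSum (fun k => b k * fourierSeries f (-k))
      (((2 * Real.pi : ℝ) : ℂ)⁻¹ ^ d * ∫ x, f x * ∑' k, b k * expo k x) := by
  have term_integrable (k) : Integrable fun x => b k * (f x * expo k x) :=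
    (integrable_mul_expo hf k).const_mul (b k)
  have summable_integral : Summable fun k => ∫ x, ‖b k * (f x * expo k x)‖ := by
    simpa only [norm_mul, norm_expo, mul_one, integral_const_mul] using hb.mul_right (∫ x, ‖f x‖)
  have hasSum_integral := (hasSum_integral_of_summable_integral_norm term_integrable
    summable_integral).mul_left (((2 * Real.pi : ℝ) : ℂ)⁻¹ ^ d)
  simpa only [fourierSeries, neg_neg, ← tsum_mul_left, mul_left_comm _ (b _),
    integral_const_mul] using hasSum_integral

theorem fourierSeries_tsum_mul_expo (hb : Summable fun k => ‖b k‖) :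
    fourierSeries (fun x : Torus d => ∑' k, b k * expo k x) = b := by
  funext l
  have coeff := hasSum_mul_fourierSeries_neg (integrable_of_continuous (continuous_expo (-l))) hb
  simp only [fourierSeries_expo, mul_comm (expo (-l) _)] at coeff
  refine coeff.unique ?_
  convert hasSum_single l fun k hk => ?_ using 1
  · simp
  · simp [hk]

end AbsolutelyConvergent

section PoissonKernel

theorem summable_norm_prod_and_tsum_prod {R ι : Type*} [NormedCommRing R] [CompleteSpace R]
    {d : ℕ} {u : Fin d → ι → R} (hu : ∀ j, Summable fun n => ‖u j n‖) :
    (Summable fun k : Fin d → ι => ‖∏ j, u j (k j)‖) ∧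
      ∑' k : Fin d → ι, ∏ j, u j (k j) = ∏ j, ∑' n, u j n := by
  induction d with
  | zero => exact ⟨(hasSum_fintype _).summable, by simp⟩
  | succ d ih =>
    obtain ⟨tail_summable, tail_tsum⟩ := ih fun j => hu j.succ
    let e : ι × (Fin d → ι) ≃ (Fin (d + 1) → ι) := Fin.consEquiv fun _ => ι
    have prod_e (x : ι × (Fin d → ι)) :
        ∏ j, u j (e x j) = u 0 x.1 * ∏ j : Fin d, u j.succ (x.2 j) := by
      simp [e, Fin.consEquiv, Fin.prod_univ_succ]
    constructor
    · rw [← e.summable_iff]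
      simpa only [Function.comp_def, prod_e] using (hu 0).mul_norm tail_summable
    · rw [← e.tsum_eq, Fin.prod_univ_succ, ← tail_tsum,
        tsum_mul_tsum_of_summable_norm (hu 0) tail_summable]
      simp only [prod_e]

theorem inv_one_sub_add_conj_mul_inv_one_sub_conj {z : ℂ} (hz : ‖z‖ < 1) :
    (1 - z)⁻¹ + starRingEnd ℂ z * (1 - starRingEnd ℂ z)⁻¹ =
      (((1 - ‖z‖ ^ 2) / (1 - 2 * z.re + ‖z‖ ^ 2) : ℝ) : ℂ) := by
  have sub_ne_zero_of_norm_lt {w : ℂ} (hw : ‖w‖ < 1) : 1 - w ≠ 0 :=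
    sub_ne_zero.2 fun h => by simp [← h] at hw
  have ne := sub_ne_zero_of_norm_lt hz
  have conj_ne := sub_ne_zero_of_norm_lt ((Complex.norm_conj z).trans_lt hz)
  have denom : (1 - z) * (1 - starRingEnd ℂ z) =
      ((1 - 2 * z.re + ‖z‖ ^ 2 : ℝ) : ℂ) := by
    linear_combination (norm := (push_cast; ring)) Complex.mul_conj' z - Complex.add_conj z
  rw [Complex.ofReal_div, ← denom, Complex.ofReal_sub, Complex.ofReal_pow, ← Complex.mul_conj']
  field_simp
  push_cast
  ring

theorem re_fourier_one (t : AddCircle (2 * Real.pi)) : (fourier 1 t).re = Real.Angle.cos t := by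
  induction t using QuotientAddGroup.induction_on with
  | H x =>
    have exponent : 2 * (Real.pi : ℂ) * Complex.I * (1 : ℤ) * x / ((2 * Real.pi : ℝ) : ℂ) =
        x * Complex.I := by
      have pi_ne_zero : (Real.pi : ℂ) ≠ 0 := Complex.ofReal_ne_zero.2 Real.pi_ne_zero
      push_cast
      field_simp
    exact (congrArg Complex.re (fourier_coe_apply.trans (congrArg Complex.exp exponent))).trans
      ((Complex.exp_ofReal_mul_I_re x).trans (Real.Angle.cos_coe x).symm)

variable {ρ : ℝ}

theorem hasSum_pow_natAbs_mul_fourier (h0 : 0 ≤ ρ) (h1 : ρ < 1) (t : AddCircle (2 * Real.pi)) :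
    HasSum (fun n : ℤ => ((ρ ^ n.natAbs : ℝ) : ℂ) * fourier n t)
      (((1 - ρ ^ 2) / (1 - 2 * ρ * Real.Angle.cos t + ρ ^ 2) : ℝ) : ℂ) := by
  set z : ℂ := ρ * fourier 1 t with hz
  have norm_z : ‖z‖ = ρ := by
    rw [hz, norm_mul, fourier_apply, Circle.norm_coe, mul_one, Complex.norm_of_nonneg h0]
  have re_z : z.re = ρ * Real.Angle.cos t := by
    rw [hz, Complex.re_ofReal_mul, re_fourier_one]
  have norm_z_lt : ‖z‖ < 1 := norm_z.trans_lt h1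
  have pow_z (n : ℕ) : z ^ n = ((ρ ^ n : ℝ) : ℂ) * fourier (n : ℤ) t := by
    simp [hz, mul_pow, fourier_apply, AddCircle.toCircle_nsmul]
  have conj_pow_z (n : ℕ) :
      starRingEnd ℂ z ^ n = ((ρ ^ n : ℝ) : ℂ) * fourier (-(n : ℤ)) t := by
    rw [← map_pow, pow_z, map_mul, Complex.conj_ofReal, fourier_neg]
  have nonneg_part := hasSum_geometric_of_norm_lt_one norm_z_lt
  have neg_part := (hasSum_geometric_of_norm_lt_one
    ((Complex.norm_conj z).trans_lt norm_z_lt)).mul_left (starRingEnd ℂ z)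
  have closed_form := inv_one_sub_add_conj_mul_inv_one_sub_conj norm_z_lt
  rw [norm_z, re_z, ← mul_assoc] at closed_form
  rw [← closed_form]
  refine HasSum.of_nat_of_neg_add_one ?_ ?_
  · simpa only [pow_z, Int.natAbs_natCast] using nonneg_part
  · simp only [← pow_succ'] at neg_part
    simpa only [conj_pow_z, Int.natAbs_neg, ← Nat.cast_succ, Int.natAbs_natCast] using neg_part

variable {d : ℕ}

theorem ofReal_pow_l1_mul_expo (ρ : ℝ) (k : Fin d → ℤ) (t : Torus d) :
    ((ρ ^ l1 k : ℝ) : ℂ) * expo k t = ∏ j, ((ρ ^ (k j).natAbs : ℝ) : ℂ) * fourier (k j) (t j) := by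
  rw [Finset.prod_mul_distrib, ← Complex.ofReal_prod, Finset.prod_pow_eq_pow_sum]
  rfl

theorem summable_pow_l1 (h0 : 0 ≤ ρ) (h1 : ρ < 1) :
    Summable fun k : Fin d → ℤ => ρ ^ l1 k := by
  have summable_norm := (summable_norm_prod_and_tsum_prod fun j : Fin d =>
    (hasSum_pow_natAbs_mul_fourier h0 h1 ((0 : Torus d) j)).summable.norm).1
  refine summable_norm.congr fun k => ?_
  rw [← ofReal_pow_l1_mul_expo ρ k 0, norm_mul, norm_expo, mul_one,
    Complex.norm_of_nonneg (pow_nonneg h0 _)]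

theorem tsum_pow_l1_mul_expo (h0 : 0 ≤ ρ) (h1 : ρ < 1) (t : Torus d) :
    ∑' k, ((ρ ^ l1 k : ℝ) : ℂ) * expo k t = poissonKernel ρ t := by
  simp only [ofReal_pow_l1_mul_expo]
  rw [(summable_norm_prod_and_tsum_prod fun j =>
    (hasSum_pow_natAbs_mul_fourier h0 h1 (t j)).summable.norm).2, poissonKernel,
    Complex.ofReal_prod]
  simp only [(hasSum_pow_natAbs_mul_fourier h0 h1 _).tsum_eq]

end PoissonKernel

section Multipliers

variable {d : ℕ} {b c : TrigSeries d} {w : ℕ → ℝ}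

theorem mem_shell {ν : ℕ} {k : Fin d → ℤ} : k ∈ shell d ν ↔ l1 k = ν := by
  rw [shell, Finset.mem_filter, and_iff_right_iff_imp]
  intro hk
  refine Fintype.mem_piFinset.2 fun j => ?_
  have natAbs_le : (k j).natAbs ≤ l1 k :=
    Finset.single_le_sum (f := fun j => (k j).natAbs) (by simp) (Finset.mem_univ j)
  rw [Finset.mem_Icc]
  omega

theorem block_smul (w : ℕ → ℝ) (c : TrigSeries d) (ν : ℕ) (x : Torus d) :
    block (fun k => w (l1 k) • c k) ν x = w ν * block c ν x := by
  rw [block, block, Finset.mul_sum]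
  refine Finset.sum_congr rfl fun k hk => ?_
  rw [mem_shell.1 hk, Complex.real_smul, mul_assoc]

theorem hasSum_block (hb : Summable fun k => ‖b k‖) (x : Torus d) :
    HasSum (fun ν => block b ν x) (∑' k, b k * expo k x) := by
  have fiber_tsum (ν : ℕ) :
      ∑' k : ↥(l1 ⁻¹' {ν} : Set (Fin d → ℤ)), b k * expo k x = block b ν x := by
    have fiber : l1 ⁻¹' {ν} = (shell d ν : Set (Fin d → ℤ)) := Set.ext fun _ => mem_shell.symm
    rw [fiber, block]
    exact Finset.tsum_subtype' (shell d ν) fun k => b k * expo k x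
  simpa only [fiber_tsum] using (hasSum_tsum_mul_expo hb x).tsum_fiberwise l1

theorem hasSum_mul_block (hw : Summable fun k => ‖w (l1 k) • c k‖) (x : Torus d) :
    HasSum (fun ν => (w ν : ℂ) * block c ν x) (∑' k, (w (l1 k) • c k) * expo k x) := by
  simpa only [block_smul] using hasSum_block hw x

theorem summable_norm_smul {σ : ℝ} (h0 : 0 ≤ σ) (h1 : σ < 1)
    (hw : w =O[atTop] fun ν => σ ^ ν) {N : ℕ} (hc : c =O[cofinite] fun k => (l1 k : ℝ) ^ N) :
    Summable fun k => ‖w (l1 k) • c k‖ := by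
  obtain ⟨τ, hστ, hτ1⟩ := exists_between h1
  have pow_mul_isBigO : (fun ν : ℕ => (ν : ℝ) ^ N * σ ^ ν) =O[atTop] fun ν => τ ^ ν :=
    (isLittleO_pow_const_mul_const_pow_const_pow_of_norm_lt N
      ((Real.norm_of_nonneg h0).trans_lt hστ)).isBigO
  refine summable_of_isBigO (summable_pow_l1 (h0.trans hστ.le) hτ1) (IsBigO.norm_left ?_)
  refine IsBigO.trans ?_ (pow_mul_isBigO.comp_tendsto tendsto_l1_cofinite_atTop)
  refine ((hw.comp_tendsto tendsto_l1_cofinite_atTop).smul hc).congr_right fun k => ?_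
  simp only [Function.comp_apply, smul_eq_mul, mul_comm]

theorem fourierSeries_poissonSeries {ρ : ℝ} (h0 : 0 ≤ ρ) (h1 : ρ < 1) {N : ℕ}
    (hc : c =O[cofinite] fun k => (l1 k : ℝ) ^ N) :
    fourierSeries (poissonSeries c ρ) = fun k => ρ ^ l1 k • c k := by
  have summable := summable_norm_smul h0 h1 (isBigO_refl (fun ν => ρ ^ ν) atTop) hc
  rw [← fourierSeries_tsum_mul_expo summable]
  congr 1
  funext x
  exact (hasSum_mul_block summable x).tsum_eq

theorem derivSeries_fourierSeries_isBigO (r : ℕ) (f : Torus d → ℂ) :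
    derivSeries r (fourierSeries f) =O[cofinite] fun k => (l1 k : ℝ) ^ r := by
  have factor_isBigO : (fun k : Fin d → ℤ => ((l1 k).descFactorial r : ℝ)) =O[cofinite]
      fun k => (l1 k : ℝ) ^ r := by
    refine .of_norm_le fun k => ?_
    rw [Real.norm_natCast]
    exact mod_cast Nat.descFactorial_le_pow (l1 k) r
  exact (factor_isBigO.smul (fourierSeries_isBigO_one f)).congr_right fun k => mul_one _

theorem fourierSeries_poissonSeries_radialDeriv (f : Torus d → ℂ) (r : ℕ) {ρ : ℝ} (h0 : 0 ≤ ρ)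
    (h1 : ρ < 1) :
    fourierSeries (poissonSeries (radialDeriv r f) ρ) =
      fun k => ρ ^ l1 k • derivSeries r (fourierSeries f) k := by
  rw [radialDeriv_eq_derivSeries,
    fourierSeries_poissonSeries h0 h1 (derivSeries_fourierSeries_isBigO r f)]

theorem tapCoeff_isBigO (r : ℕ) {ρ σ : ℝ} (h0 : 0 < ρ) (hρσ : ρ < σ) :
    (fun ν => tapCoeff r ν ρ) =O[atTop] fun ν => σ ^ ν := by
  simp only [tapCoeff]
  refine IsBigO.fun_sum fun k _ => ?_
  have pow_mul_isBigO : (fun ν : ℕ => (ν : ℝ) ^ k * ρ ^ ν) =O[atTop] fun ν => σ ^ ν :=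
    (isLittleO_pow_const_mul_const_pow_const_pow_of_norm_lt k
      ((Real.norm_of_nonneg h0.le).trans_lt hρσ)).isBigO
  refine IsBigO.trans (.of_bound (|1 - ρ| ^ k * (ρ ^ k)⁻¹) ?_) pow_mul_isBigO
  filter_upwards [eventually_ge_atTop k] with ν hν
  have choose_le : (ν.choose k : ℝ) ≤ ν ^ k := mod_cast Nat.choose_le_pow ν k
  have pow_sub : ρ ^ (ν - k) = ρ ^ ν * (ρ ^ k)⁻¹ := pow_sub₀ ρ h0.ne' hν
  simp only [norm_mul, norm_pow, Real.norm_of_nonneg h0.le, pow_sub, norm_inv,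
    Real.norm_eq_abs, Nat.abs_cast]
  calc ν.choose k * |1 - ρ| ^ k * (ρ ^ ν * (ρ ^ k)⁻¹)
      ≤ ν ^ k * |1 - ρ| ^ k * (ρ ^ ν * (ρ ^ k)⁻¹) := by gcongr
    _ = |1 - ρ| ^ k * (ρ ^ k)⁻¹ * (ν ^ k * ρ ^ ν) := by ring

theorem summable_norm_tapCoeff_smul (f : Torus d → ℂ) (r : ℕ) {ρ : ℝ} (h0 : 0 < ρ)
    (h1 : ρ < 1) :
    Summable fun k : Fin d → ℤ => ‖tapCoeff r (l1 k) ρ • fourierSeries f k‖ := by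
  obtain ⟨σ, hρσ, hσ1⟩ := exists_between h1
  refine summable_norm_smul (w := fun ν => tapCoeff r ν ρ) (N := 0) (h0.trans hρσ).le hσ1
    (tapCoeff_isBigO r h0 hρσ) ?_
  simpa only [pow_zero] using fourierSeries_isBigO_one f

theorem tapMean_eq_tsum (f : Torus d → ℂ) (r : ℕ) {ρ : ℝ} (h0 : 0 < ρ) (h1 : ρ < 1) :
    tapMean r ρ f = fun x => ∑' k, (tapCoeff r (l1 k) ρ • fourierSeries f k) * expo k x := by
  funext x
  have blocks := hasSum_mul_block (w := fun ν => tapCoeff r ν ρ)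
    (summable_norm_tapCoeff_smul f r h0 h1) x
  rw [← blocks.tsum_eq, ← blocks.summable.sum_add_tsum_nat_add r, tapMean, partialSum]
  congr 1
  refine Finset.sum_congr rfl fun ν hν => ?_
  rw [tapCoeff_of_lt (Finset.mem_range.1 hν), Complex.ofReal_one, one_mul]

theorem fourierSeries_sub_tapMean {f : Torus d → ℂ} (hf : Integrable f) (r : ℕ) {ρ : ℝ}
    (h0 : 0 < ρ) (h1 : ρ < 1) :
    fourierSeries (fun x => f x - tapMean r ρ f x) =
      fun k => (1 - tapCoeff r (l1 k) ρ) • fourierSeries f k := by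
  have summable := summable_norm_tapCoeff_smul f r h0 h1
  rw [tapMean_eq_tsum f r h0 h1, fourierSeries_sub hf (integrable_tsum_mul_expo summable),
    fourierSeries_tsum_mul_expo summable]
  simp only [sub_smul, one_smul]

end Multipliers

section PoissonIntegral

variable {d : ℕ}

theorem l1_neg (k : Fin d → ℤ) : l1 (-k) = l1 k := by
  simp [l1]

theorem poissonIntegral_eq_poissonSeries {g : Torus d → ℂ} (hg : Integrable g) {ρ : ℝ}
    (h0 : 0 ≤ ρ) (h1 : ρ < 1) : poissonIntegral g ρ = poissonSeries (fourierSeries g) ρ := by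
  funext x
  have summable_kernel : Summable fun k : Fin d → ℤ => ‖((ρ ^ l1 k : ℝ) : ℂ)‖ := by
    simpa only [Complex.norm_of_nonneg (pow_nonneg h0 _)] using summable_pow_l1 h0 h1
  have summable_smul : Summable fun k => ‖ρ ^ l1 k • fourierSeries g k‖ :=
    summable_norm_smul (N := 0) h0 h1 (isBigO_refl _ _) <| by
      simpa only [pow_zero] using fourierSeries_isBigO_one g
  have kernel_side := hasSum_mul_fourierSeries_neg (hg.comp_add_left x) summable_kernel
  rw [← (Equiv.neg (Fin d → ℤ)).hasSum_iff] at kernel_side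
  simp only [Function.comp_def, Equiv.neg_apply, neg_neg, l1_neg, fourierSeries_comp_add_left,
    tsum_pow_l1_mul_expo h0 h1] at kernel_side
  rw [poissonSeries, (hasSum_mul_block summable_smul x).tsum_eq, poissonIntegral,
    ← kernel_side.tsum_eq]
  simp only [Complex.real_smul, mul_assoc]

end PoissonIntegral

section RieszFischer

variable {d : ℕ}

theorem summable_sq_of_spNorm_lt_top {p : ℝ} (hp : 0 < p) (hp2 : p ≤ 2) {c : TrigSeries d}
    (hc : spNorm p c < ∞) : Summable fun k => ‖c k‖ ^ 2 := by
  have mem_lp : Memℓp c (.ofReal p) := by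
    refine memℓp_gen ?_
    rw [ENNReal.toReal_ofReal hp.le]
    rw [spNorm, ENNReal.rpow_lt_top_iff_of_pos (one_div_pos.2 hp)] at hc
    exact (ENNReal.summable_toReal hc.ne).congr fun k =>
      ENNReal.toReal_ofReal (Real.rpow_nonneg (norm_nonneg _) _)
  have le_two : ENNReal.ofReal p ≤ 2 := by simpa using ENNReal.ofReal_le_ofReal hp2
  simpa using (mem_lp.of_exponent_ge le_two).summable (by simp)

/-- The exponential `e^{i(k,x)}` as an element of `L²`; it has norm `(2π)^{d/2}`. -/
def expoLp (k : Fin d → ℤ) : Lp ℂ 2 (volume : Measure (Torus d)) :=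
  MemLp.toLp (expo k) (MemLp.of_bound (continuous_expo k).aestronglyMeasurable 1
    (.of_forall fun x => (norm_expo k x).le))

theorem coeFn_expoLp (k : Fin d → ℤ) : expoLp k =ᵐ[volume] expo k :=
  MemLp.coeFn_toLp _

theorem inner_expoLp (k : Fin d → ℤ) (F : Lp ℂ 2 (volume : Measure (Torus d))) :
    inner ℂ (expoLp k) F = ((2 * Real.pi : ℝ) : ℂ) ^ d * fourierSeries F k := by
  rw [fourierSeries, inv_pow, mul_inv_cancel_left₀ two_pi_pow_ne_zero, L2.inner_def]
  refine integral_congr_ae ?_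
  filter_upwards [coeFn_expoLp k] with x hx
  rw [RCLike.inner_apply, hx, conj_expo]

theorem ofReal_sqrt_two_pi_pow_ne_zero : ((√((2 * Real.pi) ^ d) : ℝ) : ℂ) ≠ 0 :=
  Complex.ofReal_ne_zero.2 (Real.sqrt_pos.2 (pow_pos Real.two_pi_pos d)).ne'

theorem fourierSeries_expoLp (k : Fin d → ℤ) : fourierSeries (expoLp k) = Pi.single k 1 := by
  rw [fourierSeries_congr_ae (coeFn_expoLp k), fourierSeries_expo]

theorem orthonormal_smul_expoLp :
    Orthonormal ℂ fun k : Fin d → ℤ => ((√((2 * Real.pi) ^ d) : ℝ) : ℂ)⁻¹ • expoLp k := by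
  have sq_sqrt : ((√((2 * Real.pi) ^ d) : ℝ) : ℂ) ^ 2 = ((2 * Real.pi : ℝ) : ℂ) ^ d :=
    mod_cast Real.sq_sqrt (pow_nonneg Real.two_pi_pos.le d)
  have sqrt_ne_zero := ofReal_sqrt_two_pi_pow_ne_zero (d := d)
  refine orthonormal_iff_ite.2 fun k l => ?_
  rw [inner_smul_left, inner_smul_right, inner_expoLp, ← sq_sqrt, fourierSeries_expoLp,
    Pi.single_apply, map_inv₀, Complex.conj_ofReal]
  split_ifs <;> field_simp

theorem summable_smul_expoLp {c : TrigSeries d} (hc : Summable fun k => ‖c k‖ ^ 2) :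
    Summable fun k => c k • expoLp k := by
  have scaled : Summable fun k => ‖(√((2 * Real.pi) ^ d) : ℂ) * c k‖ ^ 2 := by
    simpa only [norm_mul, mul_pow] using hc.mul_left _
  refine ((orthonormal_smul_expoLp.orthogonalFamily.summable_iff_norm_sq_summable
    fun k => (√((2 * Real.pi) ^ d) : ℂ) * c k).2 scaled).congr fun k => ?_
  rw [LinearIsometry.toSpanSingleton_apply, smul_smul, mul_right_comm,
    mul_inv_cancel₀ ofReal_sqrt_two_pi_pow_ne_zero, one_mul]

theorem exists_integrable_fourierSeries_eq {c : TrigSeries d}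
    (hc : Summable fun k => ‖c k‖ ^ 2) :
    ∃ g : Torus d → ℂ, Integrable g ∧ fourierSeries g = c := by
  refine ⟨↑(∑' k, c k • expoLp k), (Lp.memLp _).integrable (by norm_num), ?_⟩
  funext l
  have coeff := (innerSL ℂ (expoLp l)).hasSum (summable_smul_expoLp hc).hasSum
  simp only [innerSL_apply_apply, inner_smul_right, inner_expoLp, fourierSeries_expoLp] at coeff
  refine mul_left_cancel₀ (two_pi_pow_ne_zero (d := d)) (coeff.unique ?_)
  convert hasSum_single l fun k hk => ?_ using 1
  · simp [mul_comm]
  · simp [hk]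

end RieszFischer

section Conditions

variable {d q r : ℕ} {p : ℝ} {ω : ℝ → ℝ} {f g : Torus d → ℂ}

theorem map_one_sub_nhdsGT_zero : map (fun δ : ℝ => 1 - δ) (𝓝[>] 0) = 𝓝[<] 1 := by
  simpa only [Homeomorph.coe_subLeft, Set.image_const_sub_Ioi, sub_zero] using
    (Homeomorph.subLeft (1 : ℝ)).isEmbedding.map_nhdsWithin_eq (Set.Ioi 0) 0

theorem spBigO_iff_eBigO {F : ℝ → Torus d → ℂ} {φ : ℝ → ℝ}
    (hφ : ∀ᶠ δ in 𝓝[>] 0, 0 ≤ φ (1 - δ)) :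
    SpBigO p F φ ↔
      EBigO (𝓝[>] 0) (fun δ => spNorm p (fourierSeries (F (1 - δ))))
        fun δ => .ofReal (φ (1 - δ)) := by
  rw [eBigO_ofReal_iff hφ, SpBigO, ← map_one_sub_nhdsGT_zero]
  rfl

theorem seriesInSpH_iff_eBigO (hpos : ∀ δ ∈ Set.Ioc 0 1, 0 < ω δ) {c : TrigSeries d} :
    SeriesInSpH p ω c ↔
      spNorm p c < ∞ ∧ EBigO (𝓝[>] 0) (modulusSeries p c) fun δ => .ofReal (ω δ) := by
  rw [SeriesInSpH, eBigO_ofReal_iff]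
  filter_upwards [Ioc_mem_nhdsGT one_pos] with δ hδ using (hpos δ hδ).le

theorem approxRate_iff_eBigO (hpos : ∀ δ ∈ Set.Ioc 0 1, 0 < ω δ) (hf : Integrable f) :
    ApproxRate p (q + 1) ω f ↔
      EBigO (𝓝[>] 0) (tapError p (q + 1) (fourierSeries f))
        fun δ => .ofReal (δ ^ q) * .ofReal (ω δ) := by
  rw [ApproxRate, spBigO_iff_eBigO]
  · refine eBigO_congr ?_ ?_ <;> filter_upwards [Ioo_mem_nhdsGT one_pos] with δ hδ
    · rw [fourierSeries_sub_tapMean hf _ (sub_pos.2 hδ.2) (sub_lt_self 1 hδ.1), tapError]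
    · rw [sub_sub_cancel, add_tsub_cancel_right, ENNReal.ofReal_mul (pow_nonneg hδ.1.le q)]
  · filter_upwards [Ioc_mem_nhdsGT one_pos] with δ hδ
    rw [sub_sub_cancel]
    exact mul_nonneg (pow_nonneg hδ.1.le _) (hpos δ hδ).le

theorem poissonRate_iff_eBigO (hpos : ∀ δ ∈ Set.Ioc 0 1, 0 < ω δ) :
    PoissonRate p r ω f ↔
      EBigO (𝓝[>] 0) (fun δ => .ofReal δ * poissonNorm p (derivSeries r (fourierSeries f)) δ)
        fun δ => .ofReal (ω δ) := by
  rw [PoissonRate, spBigO_iff_eBigO,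
    ← eBigO_mul_left_iff (w := id) (l := 𝓝[>] 0) self_mem_nhdsWithin]
  · refine eBigO_congr ?_ ?_ <;> filter_upwards [Ioo_mem_nhdsGT one_pos] with δ hδ
    · rw [fourierSeries_poissonSeries_radialDeriv f r (sub_nonneg.2 hδ.2.le)
        (sub_lt_self 1 hδ.1), poissonNorm, id]
    · rw [id, sub_sub_cancel, ← ENNReal.ofReal_mul hδ.1.le, mul_div_cancel₀ _ hδ.1.ne']
  · filter_upwards [Ioc_mem_nhdsGT one_pos] with δ hδ
    rw [sub_sub_cancel]
    exact div_nonneg (hpos δ hδ).le hδ.1.le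

theorem poissonRate_iff_spBigO_poissonIntegral (hg : Integrable g)
    (hgf : fourierSeries g = radialDeriv r f) :
    PoissonRate p r ω f ↔
      SpBigO p (fun ρ => poissonIntegral g ρ) fun ρ => ω (1 - ρ) / (1 - ρ) := by
  refine exists_congr fun C => eventually_congr ?_
  filter_upwards [Ioo_mem_nhdsLT one_pos] with ρ hρ
  rw [poissonIntegral_eq_poissonSeries hg hρ.1.le hρ.2, hgf]

theorem IsMajorant.pos (hω : IsMajorant ω) : ∀ δ ∈ Set.Ioc 0 1, 0 < ω δ := by
  intro δ hδ
  have nonneg : 0 ≤ ω δ := by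
    refine le_of_tendsto hω.tendsto_zero ?_
    filter_upwards [Ioo_mem_nhdsGT hδ.1] with s hs
    exact hω.monotoneOn ⟨hs.1.le, hs.2.le.trans hδ.2⟩ ⟨hδ.1.le, hδ.2⟩ hs.2.le
  exact nonneg.lt_of_ne' (hω.ne_zero δ hδ)

theorem eq_zero_of_derivSeries_eq_zero {c : TrigSeries d} (h : derivSeries r c = 0)
    {k : Fin d → ℤ} (hk : r ≤ l1 k) : c k = 0 := by
  have coeff_eq_zero := congrFun h k
  rw [derivSeries, Pi.zero_apply, smul_eq_zero, Nat.cast_eq_zero,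
    Nat.descFactorial_eq_zero_iff_lt] at coeff_eq_zero
  exact coeff_eq_zero.resolve_left hk.not_gt

variable (hp : 1 ≤ p) (hpos : ∀ δ ∈ Set.Ioc 0 1, 0 < ω δ)
  (hmono : MonotoneOn ω (Set.Ioc 0 1)) (hB : BariCondition ω)

include hp hpos hmono hB

theorem approxRate_iff_poissonRate (hr : 1 ≤ r) (hf : Integrable f) :
    ApproxRate p r ω f ↔ PoissonRate p r ω f := by
  obtain ⟨q, rfl⟩ := Nat.exists_eq_add_of_le' hr
  rw [approxRate_iff_eBigO hpos hf, poissonRate_iff_eBigO hpos,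
    eBigO_tapError_iff hp (hB.dyadicBari hpos hmono)]

theorem PoissonRate.seriesInSpH (hr : 1 ≤ r)
    (hO : 2 ≤ r → (∀ k, r ≤ l1 k → fourierSeries f k = 0) →
      (fun δ : ℝ => δ) =O[𝓝[>] 0] ω)
    (h : PoissonRate p r ω f) : SeriesInSpH p ω (radialDeriv (r - 1) f) := by
  obtain ⟨q, rfl⟩ := Nat.exists_eq_add_of_le' hr
  rw [poissonRate_iff_eBigO hpos] at h
  rw [add_tsub_cancel_right, radialDeriv_eq_derivSeries, seriesInSpH_iff_eBigO hpos]
  refine h.modulusSeries_derivSeries hp (hB.dyadicBari hpos hmono)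
    (.of_forall fun δ => ENNReal.ofReal_lt_top) fun hq hzero => ?_
  refine eBigO_ofReal_ofReal_of_isBigO ?_
    (hO (by omega) fun k hk => eq_zero_of_derivSeries_eq_zero hzero hk)
  filter_upwards [Ioc_mem_nhdsGT one_pos] with δ hδ using (hpos δ hδ).le

theorem SeriesInSpH.poissonRate (hr : 1 ≤ r) {K : ℝ}
    (hK : ∀ k, fourierSeries f k ≠ 0 → l1 k ≤ K * |∑ j, (k j : ℝ)|)
    (h : SeriesInSpH p ω (radialDeriv (r - 1) f)) : PoissonRate p r ω f := by
  obtain ⟨q, rfl⟩ := Nat.exists_eq_add_of_le' hr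
  rw [add_tsub_cancel_right, radialDeriv_eq_derivSeries, seriesInSpH_iff_eBigO hpos] at h
  exact (poissonRate_iff_eBigO hpos).2 <|
    h.2.poissonNorm_derivSeries_succ hp (hB.dyadicBari hpos hmono) hK

theorem PoissonRate.spNorm_radialDeriv_lt_top (hr : 1 ≤ r) (h : PoissonRate p r ω f) :
    spNorm p (radialDeriv (r - 1) f) < ∞ := by
  obtain ⟨q, rfl⟩ := Nat.exists_eq_add_of_le' hr
  rw [poissonRate_iff_eBigO hpos] at h
  rw [add_tsub_cancel_right, radialDeriv_eq_derivSeries]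
  exact spNorm_derivSeries_lt_top hp (.of_forall fun δ => ENNReal.ofReal_lt_top)
    (h.spNorm_one_sub_pow_smul_derivSeries hp (hB.dyadicBari hpos hmono))

theorem PoissonRate.exists_integrable_fourierSeries_eq (hr : 1 ≤ r) (hf : Integrable f)
    (hpr : p ≤ 2 ∨ r = 1) (h : PoissonRate p r ω f) :
    ∃ g : Torus d → ℂ, Integrable g ∧ fourierSeries g = radialDeriv (r - 1) f := by
  rcases hpr with hp2 | rfl
  · exact SpApprox.exists_integrable_fourierSeries_eq <|
      summable_sq_of_spNorm_lt_top (zero_lt_one.trans_le hp) hp2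
        (h.spNorm_radialDeriv_lt_top hp hpos hmono hB hr)
  · exact ⟨f, hf, by rw [tsub_self, radialDeriv_eq_derivSeries, derivSeries_zero]⟩

end Conditions

end SpApprox

end

open SpApprox in
theorem theorem3p4_general (d r : ℕ) (hr : 1 ≤ r) (p : ℝ) (hp : 1 ≤ p)
    (ω : ℝ → ℝ) (hpos : ∀ δ ∈ Set.Ioc 0 1, 0 < ω δ) (hmono : MonotoneOn ω (Set.Ioc 0 1))
    (hB : BariCondition ω) (f : Torus d → ℂ) (hf : Integrable f) :
    (ApproxRate p r ω f ↔ PoissonRate p r ω f) ∧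
    ((2 ≤ r → (∀ k, r ≤ l1 k → fourierSeries f k = 0) →
        (fun δ : ℝ => δ) =O[𝓝[>] (0 : ℝ)] ω) →
      (ApproxRate p r ω f ∨ PoissonRate p r ω f) →
        SeriesInSpH p ω (radialDeriv (r - 1) f)) ∧
    (∀ K : ℝ, (∀ k, fourierSeries f k ≠ 0 → l1 k ≤ K * |∑ j, (k j : ℝ)|) →
      SeriesInSpH p ω (radialDeriv (r - 1) f) → ApproxRate p r ω f ∧ PoissonRate p r ω f) ∧
    (∀ g : Torus d → ℂ, Integrable g → fourierSeries g = radialDeriv r f →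
      (PoissonRate p r ω f ↔
        SpBigO p (fun ρ => poissonIntegral g ρ) fun ρ => ω (1 - ρ) / (1 - ρ))) ∧
    (∀ g : Torus d → ℂ, Integrable g → fourierSeries g = radialDeriv (r - 1) f →
      (SeriesInSpH p ω (radialDeriv (r - 1) f) ↔ InSpH p ω g)) ∧
    (p ≤ 2 ∨ r = 1 → (ApproxRate p r ω f ∨ PoissonRate p r ω f) →
      ∃ g : Torus d → ℂ, Integrable g ∧ fourierSeries g = radialDeriv (r - 1) f) := by
  have rates_iff : ApproxRate p r ω f ↔ PoissonRate p r ω f :=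
    approxRate_iff_poissonRate hp hpos hmono hB hr hf
  simp only [rates_iff, or_self, and_self, true_and]
  refine ⟨fun hO hpoisson => hpoisson.seriesInSpH hp hpos hmono hB hr hO,
    fun K hK hseries => hseries.poissonRate hp hpos hmono hB hr hK,
    fun g hg hgf => poissonRate_iff_spBigO_poissonIntegral hg hgf,
    fun g hg hgf => by rw [inSpH_iff hg, hgf],
    fun hpr hpoisson => hpoisson.exists_integrable_fourierSeries_eq hp hpos hmono hB hr hf hpr⟩

open SpApprox in
theorem theorem3p4 (d r : ℕ) (hd : 1 ≤ d) (hr : 1 ≤ r) (p : ℝ) (hp : 1 ≤ p)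
    (ω : ℝ → ℝ) (hω : IsMajorant ω) (hB : BariCondition ω)
    (f : Torus d → ℂ) (hf : MeasureTheory.Integrable f) :
    -- i) and ii) are equivalent
    (ApproxRate p r ω f ↔ PoissonRate p r ω f) ∧
    -- i) or ii) implies iii); when `r ≥ 2` and `f` is a polynomial of degree at most `r - 1`,
    -- this needs `δ = O(ω(δ))`
    ((2 ≤ r → (∀ k, r ≤ l1 k → fourierSeries f k = 0) →
        (fun δ : ℝ => δ) =O[𝓝[>] (0 : ℝ)] ω) →
      (ApproxRate p r ω f ∨ PoissonRate p r ω f) →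
        SeriesInSpH p ω (radialDeriv (r - 1) f)) ∧
    -- if the spectrum of `f` lies in `ℤ_+^d ∪ ℤ_-^d`, then iii) implies i) and ii)
    (SpectrumInY f → SeriesInSpH p ω (radialDeriv (r - 1) f) →
      ApproxRate p r ω f ∧ PoissonRate p r ω f) ∧
    -- if `f^{[r]}` is a function, then ii) is the condition on its Poisson integral
    (∀ g : Torus d → ℂ, MeasureTheory.Integrable g → fourierSeries g = radialDeriv r f →
      (PoissonRate p r ω f ↔
        SpBigO p (fun ρ => poissonIntegral g ρ) fun ρ => ω (1 - ρ) / (1 - ρ))) ∧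
    -- if `f^{[r-1]}` is a function, then iii) is the condition on this function
    (∀ g : Torus d → ℂ, MeasureTheory.Integrable g → fourierSeries g = radialDeriv (r - 1) f →
      (SeriesInSpH p ω (radialDeriv (r - 1) f) ↔ InSpH p ω g)) ∧
    -- under i) or ii), `f^{[r-1]}` is a function whenever `p ≤ 2` or `r = 1`
    (p ≤ 2 ∨ r = 1 → (ApproxRate p r ω f ∨ PoissonRate p r ω f) →
      ∃ g : Torus d → ℂ, MeasureTheory.Integrable g ∧ fourierSeries g = radialDeriv (r - 1) f) := by
  obtain ⟨rates_iff, smooth_of_rate, rate_of_smooth, rest⟩ :=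
    theorem3p4_general d r hr p hp ω hω.pos (hω.monotoneOn.mono Set.Ioc_subset_Icc_self) hB f hf
  refine ⟨rates_iff, smooth_of_rate, fun hY => rate_of_smooth 1 fun k hk => ?_, rest⟩
  rw [one_mul, abs_sum_eq_l1 (not_not.1 (mt (hY k) hk))]
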